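/- Let $S$ be the shift $S(x)(i)=x(i+1)$ on $\mathsf A^{\mathbb Z}$. Let $\boldsymbol S$ be the space of all (nonempty) subshifts $X\subseteq \mathsf A^{\mathbb Z}$ over finite alphabets $\mathsf A\subseteq\mathbb Z$, with the Borel structure of the Hausdorff metric (Vietoris topology). For $X,Y\in\boldsymbol S$: * $X,Y$ are *conjugate* if there is a homeomorphism $\varphi\colon X\to Y$ with $\varphi\circ S=S\circ\varphi$; * $X,Y$ are *flip conjugate* if $(X,S)$ is conjugate to $(Y,S)$ or to $(Y,S^{-1})$; * $X,Y$ are *bi-factors* of each other if there are continuous shift-commuting surjections $X\to Y$ and $Y\to X$. A directive sequence $\boldsymbol\tau=(\tau_n\colon A_{n+1}^*\to A_n^*)_{n\ge 0}$ is a sequence of non-erasing morphisms between finite alphabets. Put $\tau_{[n,N)}=\tau_n\circ\cdots\circ\tau_{N-1}$, and let $X^{(n)}_{\boldsymbol\tau}\subseteq A_n^{\mathbb Z}$ be the set of all $x$ each of whose finite subwords occurs in some $\tau_{[n,N)}(a)$ with $N>n$, $a\in A_N$. Then $X_{\boldsymbol\tau}=X_{\boldsymbol\tau}^{(0)}$ is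 the $\mathcal S$-adic subshift generated by $\boldsymbol\tau$, and $\liminf_n|A_n|$ is the alphabet rank of $\boldsymbol\tau$. We say that $\boldsymbol\tau$ is of *constant length* if for each $n$ the length $|\tau_n(a)|$ does not depend on $a$; *primitive* if for every $n$ there is $N>n$ such that every letter of $A_n$ occurs in $\tau_{[n,N)}(a)$ for every $a\in A_N$; *proper* if for every $n$ all the words $\tau_n(a)$ have the same first letter and the same last letter; *recognizable* if for every $n$ each $x\in A_n^{\mathbb Z}$ can be written in at most one way as $x=S^k\tau_n(y)$ with $y\in X^{(n+1)}_{\boldsymbol\tau}$ and $0\le k<|\tau_n(y(0))|$. A subshift is a *strong Toeplitz subshift of rank $2$* if it is conjugate to $X_{\boldsymbol\tau}$ for some constant-length, primitive, proper and recognizable $\boldsymbol\tau$ of alphabet rank at most $2$. Let $\boldsymbol T_2\subseteq\boldsymbol S$ be the class of all aperiodic Toeplitz subshifts of topological rank $2$: those $X$ that are the orbit closure of a Toeplitz sequence (a sequence $x$ such that for every $i\in\mathbb Z$ there is $p\ge1$ with $x(i+kp)=x(i)$ for all $k\in\mathbb Z$), contain no periodic point, and for which $2$ is the minimum of the ranks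 $\liminf_n|V_n|$ of the simple properly ordered Bratteli diagrams $(V,E,\preceq)$ whose Bratteli--Vershik system is conjugate to $(X,S)$. An equivalence relation $E$ on a class $\boldsymbol C\subseteq\boldsymbol S$ is *smooth* if there are a standard Borel space $Z$ and a Borel map $f\colon\boldsymbol C\to Z$ (for the Borel structure inherited from $\boldsymbol S$) with $X\,E\,Y\iff f(X)=f(Y)$ for all $X,Y\in \boldsymbol C$. **Proposition.** On the class of all strong Toeplitz subshifts of rank $2$, none of the following relations is smooth: (i) the conjugacy relation; (ii) the flip conjugacy relation; (iii) the bi-factor relation. Likewise, none of these three relations is smooth on $\boldsymbol T_2$. -/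

import Mathlib

open Filter Topology TopologicalSpace

noncomputable section

namespace ToeplitzRank

/-! ### Topological dynamical systems -/

/-- `(X, T)` and `(Y, T')` are conjugate. -/
def Conjugate {X Y : Type*} [TopologicalSpace X] [TopologicalSpace Y]
    (T : X ≃ₜ X) (T' : Y ≃ₜ Y) : Prop :=
  ∃ φ : X ≃ₜ Y, ∀ x, φ (T x) = T' (φ x)

/-- `(Y, T')` is a factor of `(X, T)`. -/
def IsFactorOf {X Y : Type*} [TopologicalSpace X] [TopologicalSpace Y]
    (T' : Y ≃ₜ Y) (T : X ≃ₜ X) : Prop :=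
  ∃ φ : X → Y, Continuous φ ∧ Function.Surjective φ ∧ ∀ x, φ (T x) = T' (φ x)

/-- The Bernoulli shift `S(x)(i) = x(i+1)` on bi-infinite sequences. -/
def shift (A : Type*) [TopologicalSpace A] : (ℤ → A) ≃ₜ (ℤ → A) where
  toFun x i := x (i + 1)
  invFun x i := x (i - 1)
  left_inv x := by funext i; simp
  right_inv x := by funext i; simp
  continuous_toFun := by fun_prop
  continuous_invFun := by fun_prop

/-- The restriction of the shift to an invariant set. -/
def shiftOn {A : Type*} [TopologicalSpace A] (X : Set (ℤ → A))
    (hX : ∀ x, x ∈ X ↔ shift A x ∈ X) : X ≃ₜ X :=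
  (shift A).subtype hX

/-- The finite word `x[i, i+m)`. -/
def word {A : Type*} (x : ℤ → A) (i : ℤ) (m : ℕ) : List A :=
  (List.range m).map fun j => x (i + j)

theorem word_shift {A : Type*} [TopologicalSpace A] (x : ℤ → A) (i : ℤ) (m : ℕ) :
    word (shift A x) i m = word x (i + 1) m := by
  simp only [word, shift, Homeomorph.homeomorph_mk_coe, Equiv.coe_fn_mk]
  congr 1
  funext j
  congr 1
  ring

/-! ### The standard Borel space of subshifts -/

/-- The space of all (nonempty) subshifts over a finite alphabet `A ⊆ ℤ`. A shift-invariant compact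
subset of `ℤ → ℤ` only uses finitely many letters, so these are exactly the nonempty closed
shift-invariant subsets of the spaces `ℤ → A` with `A ⊆ ℤ` finite. -/
def Subshift : Type :=
  {X : NonemptyCompacts (ℤ → ℤ) // ∀ x, x ∈ (X : Set (ℤ → ℤ)) ↔ shift ℤ x ∈ (X : Set (ℤ → ℤ))}

/-- The underlying set of a subshift. -/
def Subshift.carrier (X : Subshift) : Set (ℤ → ℤ) := (X.1 : Set (ℤ → ℤ))

/-- The Vietoris topology, i.e. the topology of the Hausdorff metric. -/
instance : TopologicalSpace Subshift := instTopologicalSpaceSubtype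

instance : MeasurableSpace Subshift := borel Subshift

instance : BorelSpace Subshift := ⟨rfl⟩

/-- The shift `S` acting on the subshift `X`. -/
def Subshift.map (X : Subshift) : X.carrier ≃ₜ X.carrier := shiftOn X.carrier X.2

/-- The conjugacy relation. -/
def conj (X Y : Subshift) : Prop := Conjugate X.map Y.map

/-- The flip conjugacy relation: `(X, S)` is conjugate to `(Y, S)` or to `(Y, S⁻¹)`. -/
def flipConj (X Y : Subshift) : Prop := Conjugate X.map Y.map ∨ Conjugate X.map Y.map.symm

/-- The bi-factor relation. -/
def biFactor (X Y : Subshift) : Prop := IsFactorOf X.map Y.map ∧ IsFactorOf Y.map X.map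

/-! ### Smoothness -/

/-- `E` is smooth: Borel reducible to equality on some standard Borel space. -/
def Smooth {X : Type*} [MeasurableSpace X] (E : X → X → Prop) : Prop :=
  ∃ (Y : Type) (_ : MeasurableSpace Y) (_ : StandardBorelSpace Y) (f : X → Y),
    Measurable f ∧ ∀ x x', E x x' ↔ f x = f x'

/-- The restriction of `E` to the subspace `C` is smooth. -/
def SmoothOn {X : Type*} [MeasurableSpace X] (E : X → X → Prop) (C : Set X) : Prop :=
  Smooth fun x y : C => E x y

/-! ### Directive sequences and `S`-adic subshifts -/

/-- A directive sequence of non-erasing morphisms `τ_n : A_{n+1}^* → A_n^*` between finite alphabets;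
a morphism is given by its values on letters. -/
structure DirectiveSequence where
  alphabet : ℕ → Type
  finite_alphabet : ∀ n, Finite (alphabet n)
  mor : ∀ n, alphabet (n + 1) → List (alphabet n)
  nonerasing : ∀ n a, mor n a ≠ []

namespace DirectiveSequence

variable (τ : DirectiveSequence)

/-- Alphabets are discrete. -/
instance (n : ℕ) : TopologicalSpace (τ.alphabet n) := ⊥

/-- `τ.comp n k` is the morphism `τ_{[n, n+k)} = τ_n ∘ ⋯ ∘ τ_{n+k-1}` on letters. -/
def comp (n : ℕ) : ∀ k : ℕ, τ.alphabet (n + k) → List (τ.alphabet n)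
  | 0, a => [a]
  | k + 1, a => (τ.mor (n + k) a).flatMap (comp n k)

/-- The language `L^{(n)}(τ)`. -/
def language (n : ℕ) : Set (List (τ.alphabet n)) :=
  {w | ∃ (k : ℕ) (a : τ.alphabet (n + (k + 1))), w <:+: τ.comp n (k + 1) a}

/-- The subshift `X^{(n)}_τ`. -/
def level (n : ℕ) : Set (ℤ → τ.alphabet n) :=
  {x | ∀ (i : ℤ) (m : ℕ), word x i m ∈ τ.language n}

theorem level_invariant (n : ℕ) (x : ℤ → τ.alphabet n) :
    x ∈ τ.level n ↔ shift _ x ∈ τ.level n := by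
  constructor
  · intro h i m
    rw [word_shift]
    exact h _ _
  · intro h i m
    have := h (i - 1) m
    rwa [word_shift, sub_add_cancel] at this

/-- The shift acting on the `S`-adic subshift `X_τ = X^{(0)}_τ`. -/
def map : τ.level 0 ≃ₜ τ.level 0 := shiftOn (τ.level 0) (τ.level_invariant 0)

/-- The alphabet rank `liminf_n |A_n|`. -/
def alphabetRank : ℕ∞ := liminf (fun n => (Nat.card (τ.alphabet n) : ℕ∞)) atTop

def Primitive : Prop :=
  ∀ n, ∃ k, 0 < k ∧ ∀ (a : τ.alphabet (n + k)) (b : τ.alphabet n), b ∈ τ.comp n k a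

def Proper : Prop :=
  ∀ n, ∃ p q : τ.alphabet n, ∀ a : τ.alphabet (n + 1),
    (τ.mor n a).head? = some p ∧ (τ.mor n a).getLast? = some q

def ConstantLength : Prop :=
  ∀ n, ∀ a b : τ.alphabet (n + 1), (τ.mor n a).length = (τ.mor n b).length

end DirectiveSequence

/-- The position in `σ(y) = ⋯σ(y(-1)).σ(y(0))σ(y(1))⋯` at which the word `σ(y(i))` begins. -/
def cutPoint {A B : Type*} (σ : A → List B) (y : ℤ → A) (i : ℤ) : ℤ :=
  ∑ j ∈ Finset.Ico 0 i, ((σ (y j)).length : ℤ) - ∑ j ∈ Finset.Ico i 0, ((σ (y j)).length : ℤ)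

/-- `(y, k)` is a centered `σ`-representation of `x`: `x = S^k σ(y)` and `0 ≤ k < |σ(y(0))|`. -/
def IsCenteredRep {A B : Type*} (σ : A → List B) (x : ℤ → B) (y : ℤ → A) (k : ℕ) : Prop :=
  k < (σ (y 0)).length ∧
    ∀ (i : ℤ) (j : ℕ) (hj : j < (σ (y i)).length), x (cutPoint σ y i + j - k) = (σ (y i))[j]

/-- `σ` is recognizable in `Y`: every `x` has at most one centered `σ`-representation in `Y`. -/
def RecognizableIn {A B : Type*} (σ : A → List B) (Y : Set (ℤ → A)) : Prop :=
  ∀ (x : ℤ → B) (y y' : ℤ → A) (k k' : ℕ), y ∈ Y → y' ∈ Y →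
    IsCenteredRep σ x y k → IsCenteredRep σ x y' k' → y = y' ∧ k = k'

def DirectiveSequence.Recognizable (τ : DirectiveSequence) : Prop :=
  ∀ n, RecognizableIn (τ.mor n) (τ.level (n + 1))

/-- `X` is a strong Toeplitz subshift of rank `K`. -/
def IsStrongToeplitz (K : ℕ) (X : Subshift) : Prop :=
  ∃ τ : DirectiveSequence, τ.ConstantLength ∧ τ.Primitive ∧ τ.Proper ∧ τ.Recognizable ∧
    τ.alphabetRank ≤ K ∧ Conjugate X.map τ.map

/-! ### Aperiodic Toeplitz subshifts -/

def IsToeplitzSeq {A : Type*} (x : ℤ → A) : Prop :=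
  ∀ i : ℤ, ∃ p : ℕ, 1 ≤ p ∧ ∀ k : ℤ, x (i + k * p) = x i

def IsPeriodicSeq {A : Type*} (x : ℤ → A) : Prop :=
  ∃ p : ℕ, 1 ≤ p ∧ ∀ i : ℤ, x (i + p) = x i

/-- `X` is the closure of the orbit `{S^k x : k ∈ ℤ}` of a Toeplitz sequence `x`. -/
def IsToeplitz (X : Subshift) : Prop :=
  ∃ x : ℤ → ℤ, IsToeplitzSeq x ∧
    X.carrier = closure (Set.range fun k : ℤ => fun i : ℤ => x (i + k))

def IsAperiodic (X : Subshift) : Prop := ∀ x ∈ X.carrier, ¬ IsPeriodicSeq x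

/-! ### Bratteli–Vershik systems and topological rank -/

/-- An ordered Bratteli diagram. `E n` is the set of edges from `V n` to `V (n + 1)`. -/
structure OrderedBratteliDiagram where
  V : ℕ → Type
  E : ℕ → Type
  finite_V : ∀ n, Finite (V n)
  finite_E : ∀ n, Finite (E n)
  card_V_zero : Nat.card (V 0) = 1
  source : ∀ n, E n → V n
  range : ∀ n, E n → V (n + 1)
  source_surjective : ∀ n, Function.Surjective (source n)
  range_surjective : ∀ n, Function.Surjective (range n)
  order : ∀ n, PartialOrder (E n)
  comparable_iff : ∀ n (e f : E n), (e ≤ f ∨ f ≤ e) ↔ range n e = range n f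

namespace OrderedBratteliDiagram

variable (B : OrderedBratteliDiagram)

instance (n : ℕ) : PartialOrder (B.E n) := B.order n

/-- Edge sets are discrete. -/
instance (n : ℕ) : TopologicalSpace (B.E n) := ⊥

/-- There is a finite path from `u ∈ V n` to `v ∈ V (n + k)`. -/
def Reaches {n : ℕ} (u : B.V n) : ∀ k : ℕ, B.V (n + k) → Prop
  | 0, v => u = v
  | k + 1, v => ∃ e : B.E (n + k), B.range (n + k) e = v ∧ Reaches u k (B.source (n + k) e)

/-- Simplicity: for every `n` there is `m > n` such that all vertices of `V n` are connected to all
vertices of `V m`. -/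
def Simple : Prop :=
  ∀ n, ∃ k, 0 < k ∧ ∀ (u : B.V n) (v : B.V (n + k)), B.Reaches u k v

/-- The space of infinite paths. -/
def PathSpace : Type :=
  {e : ∀ n, B.E n // ∀ n, B.range n (e n) = B.source (n + 1) (e (n + 1))}

instance : TopologicalSpace B.PathSpace := instTopologicalSpaceSubtype

/-- There are a unique maximal and a unique minimal infinite path. -/
def ProperlyOrdered : Prop :=
  (∃! x : B.PathSpace, ∀ n, IsMax (x.1 n)) ∧ (∃! x : B.PathSpace, ∀ n, IsMin (x.1 n))

/-- `T` is the Vershik map: it sends the maximal path to the minimal one, and if `k` is least such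
that the `k`-th edge of `x` is not maximal, it replaces this edge by its successor, keeps all later
edges, and takes the minimal edges before it. For properly ordered `B` this determines `T`. -/
def IsVershikMap (T : B.PathSpace → B.PathSpace) : Prop :=
  (∀ x : B.PathSpace, (∀ n, IsMax (x.1 n)) → ∀ n, IsMin ((T x).1 n)) ∧
  ∀ (x : B.PathSpace) (k : ℕ), (∀ j < k, IsMax (x.1 j)) → ¬ IsMax (x.1 k) →
    x.1 k ⋖ (T x).1 k ∧ (∀ j < k, IsMin ((T x).1 j)) ∧ ∀ j, k < j → (T x).1 j = x.1 j

/-- The rank `liminf_n |V_n|`. -/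
def rank : ℕ∞ := liminf (fun n => (Nat.card (B.V n) : ℕ∞)) atTop

end OrderedBratteliDiagram

/-- `(X, T)` has a Bratteli–Vershik representation of rank `K`. -/
def HasBVRepresentation {X : Type*} [TopologicalSpace X] (T : X ≃ₜ X) (K : ℕ∞) : Prop :=
  ∃ B : OrderedBratteliDiagram, B.Simple ∧ B.ProperlyOrdered ∧ B.rank = K ∧
    ∃ T' : B.PathSpace ≃ₜ B.PathSpace, B.IsVershikMap T' ∧ Conjugate T T'

/-- `(X, T)` has topological rank `K`: the least rank of a Bratteli–Vershik representation is `K`. -/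
def HasTopologicalRank {X : Type*} [TopologicalSpace X] (T : X ≃ₜ X) (K : ℕ) : Prop :=
  IsLeast {k : ℕ∞ | HasBVRepresentation T k} K

/-- The class of all strong Toeplitz subshifts of rank `2`. -/
def strongToeplitz₂ : Set Subshift := {X | IsStrongToeplitz 2 X}

/-- The class `T₂` of all aperiodic Toeplitz subshifts of topological rank `2`. -/
def toeplitz₂ : Set Subshift :=
  {X | IsToeplitz X ∧ IsAperiodic X ∧ HasTopologicalRank X.map 2}

end ToeplitzRank

end

/-! To each bit sequence `x` belongs the Toeplitz subshift `family x` generated by the morphisms a ↦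
c a c̄ with c = x n, c̄ being the other letter. The theorem embeds tail equivalence of bit sequences
into all three relations by this single family.

Three facts carry the argument. (1) Parsing a point into blocks c a c̄ is unique, because a
misaligned parse would make the desubstituted sequence constant. Hence `x` can be read off from any
point, and `family` is injective; it is also continuous. (2) `base x` is a tower of height 3 over
`base (tail x 1)`, and the dynamics of this tower does not involve x 0. Changing finitely many
entries of `x` therefore preserves the conjugacy class (`conjugate_of_eventuallyEq`). (3) A factor
map onto a subshift is determined by one continuous integer-valued function, and a compact second
countable space carries only countably many of these; so all three relations have countable classes.

If such a relation were smooth, each bit of a Borel reduction would be tail invariant, hence almost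
surely constant by Kolmogorov's zero-one law. Almost every `x` would then lie in one countable set,
which is absurd (`not_smoothOn_of_tail`).

It remains to see that the family lies in both classes. The morphisms give the directive sequence,
whose levels are the sets `base (tail x n)` (`mem_level_iff`). Recording the offset and the letter
at the origin on all levels turns points into paths of a diagram with two vertices per level, and
the shift into the Vershik map. Rank below 2 would leave single vertices at infinitely many levels
and force periodic points (`two_le_of_hasBVRepresentation`). -/

open MeasureTheory

noncomputable section

namespace ToeplitzRank

/-! ### A criterion for non-smoothness -/

/-- The fair coin. -/
def coin : Measure Bool := (PMF.uniformOfFintype Bool).toMeasure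

instance : IsProbabilityMeasure coin := by unfold coin; infer_instance

/-- The fair coin-tossing measure on the Cantor space. -/
def coins : Measure (ℕ → Bool) := Measure.infinitePi fun _ => coin

instance : IsProbabilityMeasure coins := by unfold coins; infer_instance

theorem coin_singleton (b : Bool) : coin {b} = 2⁻¹ := by
  rw [coin, PMF.toMeasure_apply_singleton _ _ (MeasurableSet.singleton b)]
  simp

theorem coins_singleton (x : ℕ → Bool) : coins {x} = 0 := by
  have h : ∀ n : ℕ, coins {x} ≤ (2⁻¹ : ENNReal) ^ n := fun n => by
    calc coins {x} ≤ coins (Set.pi (Finset.range n) fun i => {x i}) := by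
          apply measure_mono
          rintro _ rfl
          simp [Set.mem_pi]
      _ = (2⁻¹ : ENNReal) ^ n := by
          rw [coins, Measure.infinitePi_pi _ (fun i _ => MeasurableSet.singleton _)]
          simp [coin_singleton]
  have h0 : Tendsto (fun n : ℕ => (2⁻¹ : ENNReal) ^ n) atTop (𝓝 0) :=
    ENNReal.tendsto_pow_atTop_nhds_zero_of_lt_one (by simp)
  exact le_antisymm (ge_of_tendsto' h0 h) zero_le

/-- Kolmogorov's zero-one law for sets invariant under changing finitely many coordinates. -/
theorem coins_zero_or_one {t : Set (ℕ → Bool)} (ht : MeasurableSet t)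
    (inv : ∀ (x y : ℕ → Bool) (n : ℕ), (∀ m, n ≤ m → x m = y m) → (x ∈ t ↔ y ∈ t)) :
    coins t = 0 ∨ coins t = 1 := by
  have hind : ProbabilityTheory.iIndepFun (fun (i : ℕ) (ω : ℕ → Bool) => ω i) coins :=
    ProbabilityTheory.iIndepFun_infinitePi (X := fun _ b => b) (fun _ => measurable_id)
  refine ProbabilityTheory.measure_zero_or_one_of_measurableSet_limsup_atTop
    (s := fun i => MeasurableSpace.comap (fun ω : ℕ → Bool => ω i) inferInstance)
    (fun i => (measurable_pi_apply i).comap_le) hind ?_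
  rw [limsup_eq_iInf_iSup_of_nat, MeasurableSpace.measurableSet_iInf]
  intro n
  -- Resetting the first `n` coordinates does not affect membership in `t`, so `t` is measurable
  -- with respect to the coordinates from `n` on, for every `n`.
  set r : (ℕ → Bool) → ℕ → Bool := fun x m => if m < n then false else x m with hr
  have hrt : t = r ⁻¹' t := by
    ext x
    refine inv x (r x) n fun m hm => ?_
    simp [hr, not_lt.2 hm]
  rw [hrt]
  refine @measurableSet_preimage _ _ (_) _ _ _ ?_ ht
  refine @measurable_pi_lambda _ _ _ (_) _ _ fun m => ?_
  by_cases hm : m < n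
  · simp only [hr, hm, if_true]
    exact @measurable_const _ _ _ (_) _
  · simp only [hr, hm, if_false]
    refine Measurable.mono (comap_measurable _) ?_ le_rfl
    exact le_iSup₂_of_le m (not_lt.1 hm) le_rfl

/-- A relation with countable classes is not smooth on a class that contains an injective measurable
family indexed by the Cantor space in which tail equivalent indices give related members. -/
theorem not_smoothOn_of_tail {X : Type*} [MeasurableSpace X] {E : X → X → Prop} {C : Set X}
    {f : (ℕ → Bool) → X} (hf : Measurable f) (hinj : Function.Injective f) (hC : ∀ x, f x ∈ C)
    (htail : ∀ (x y : ℕ → Bool) (n : ℕ), (∀ m, n ≤ m → x m = y m) → E (f x) (f y))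
    (hcount : ∀ Y, {X | E X Y}.Countable) : ¬ SmoothOn E C := by
  rintro ⟨Z, _, _, g, hg, hE⟩
  -- Embedding `Z` into the Cantor space allows the reduction to be treated bit by bit.
  obtain ⟨e, he, heinj⟩ := MeasurableSpace.measurable_injection_nat_bool_of_countablySeparated Z
  set F : (ℕ → Bool) → ℕ → Bool := fun x => e (g ⟨f x, hC x⟩) with hF
  have hFm : Measurable F := he.comp (hg.comp (hf.subtype_mk))
  have hFE : ∀ x y, F x = F y ↔ E (f x) (f y) := fun x y =>
    heinj.eq_iff.trans (hE ⟨f x, hC x⟩ ⟨f y, hC y⟩).symm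
  have hconst : ∀ n, ∃ b, ∀ᵐ x ∂coins, F x n = b := by
    intro n
    have hm : MeasurableSet {x | F x n = true} :=
      ((measurable_pi_apply n).comp hFm) (MeasurableSet.singleton true)
    rcases coins_zero_or_one hm fun x y k h => by
        simp only [Set.mem_ofPred_eq, (hFE x y).2 (htail x y k h)] with h | h
    · refine ⟨false, ?_⟩
      have : ∀ᵐ x ∂coins, ¬ F x n = true := measure_eq_zero_iff_ae_notMem.1 h
      filter_upwards [this] with x hx using by simpa using hx
    · exact ⟨true, (prob_compl_eq_zero_iff hm).2 h⟩
  choose b hb using hconst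
  have hae : ∀ᵐ x ∂coins, F x = b := by
    filter_upwards [ae_all_iff.2 hb] with x hx using funext hx
  obtain ⟨x₀, hx₀⟩ := hae.exists
  -- The fibre over `b` lies in the preimage of a single class under the injective `f`; being
  -- countable, it is null, although it has full measure.
  have hc : {x | F x = b}.Countable := by
    refine ((hcount (f x₀)).preimage_of_injOn hinj.injOn).mono fun x hx => ?_
    exact (hFE x x₀).1 ((show F x = b from hx).trans hx₀.symm)
  have h0 : coins {x | F x = b} = 0 := by
    rw [← Set.biUnion_of_singleton {x | F x = b}]
    exact (measure_biUnion_null_iff hc).2 fun x _ => coins_singleton x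
  have h1 : coins {x | F x = b}ᶜ = 0 := hae
  have : coins Set.univ = 0 := by
    rw [← Set.union_compl_self {x | F x = b}]
    exact measure_union_null h0 h1
  simp at this

/-! ### Classes are countable -/

/-- Integer-valued functions at uniform distance less than 1 coincide, so this separable metric
space is discrete. -/
theorem countable_continuousMap_int (K : Type*) [TopologicalSpace K] [CompactSpace K]
    [SecondCountableTopology K] [LocallyCompactSpace K] : Countable C(K, ℤ) := by
  have : DiscreteTopology C(K, ℤ) := by
    rw [discreteTopology_iff_isOpen_singleton]
    intro f
    have h : ({f} : Set C(K, ℤ)) = Metric.ball f 1 := by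
      ext g
      simp only [Set.mem_singleton_iff, Metric.mem_ball]
      constructor
      · rintro rfl
        simp
      · intro h
        ext x
        have h2 := (ContinuousMap.dist_apply_le_dist (f := g) (g := f) x).trans_lt h
        rw [Int.dist_eq] at h2
        have h3 : |g x - f x| < 1 := by exact_mod_cast h2
        have := Int.abs_lt_one_iff.1 h3
        omega
    rw [h]
    exact Metric.isOpen_ball
  exact separableSpace_iff_countable.1 inferInstance

theorem Subshift.ext_carrier {X Y : Subshift} (h : X.carrier = Y.carrier) : X = Y :=
  Subtype.ext (NonemptyCompacts.ext h)

theorem Subshift.isCompact_carrier (X : Subshift) : IsCompact X.carrier := X.1.isCompact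

instance (X : Subshift) : CompactSpace X.carrier := isCompact_iff_compactSpace.1 X.isCompact_carrier

@[simp]
theorem Subshift.map_apply (X : Subshift) (x : X.carrier) (i : ℤ) :
    (X.map x).1 i = x.1 (i + 1) := rfl

@[simp]
theorem Subshift.map_symm_apply (X : Subshift) (x : X.carrier) (i : ℤ) :
    (X.map.symm x).1 i = x.1 (i - 1) := rfl

theorem map_symm_of_comm {X Y : Type*} [TopologicalSpace X] [TopologicalSpace Y]
    {T : X ≃ₜ X} {T' : Y ≃ₜ Y} {φ : X → Y} (h : ∀ x, φ (T x) = T' (φ x)) (x : X) :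
    φ (T.symm x) = T'.symm (φ x) := by
  rw [Homeomorph.eq_symm_apply, ← h, T.apply_symm_apply]

/-- A factor map to a subshift is determined by its coordinate at the origin. -/
theorem factorMap_unique {K : Type*} [TopologicalSpace K] {T : K ≃ₜ K} {X X' : Subshift}
    {φ : K → X.carrier} {φ' : K → X'.carrier} (h : ∀ x, φ (T x) = X.map (φ x))
    (h' : ∀ x, φ' (T x) = X'.map (φ' x)) (h0 : ∀ x, (φ x).1 0 = (φ' x).1 0) (x : K) :
    (φ x).1 = (φ' x).1 := by
  funext i
  induction i using Int.induction_on generalizing x with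
  | zero => exact h0 x
  | succ n ih =>
    have := ih (T x)
    rwa [h, h', X.map_apply, X'.map_apply] at this
  | pred n ih =>
    have := ih (T.symm x)
    rwa [map_symm_of_comm h, map_symm_of_comm h', X.map_symm_apply, X'.map_symm_apply] at this

/-- The factor is the image of its factor map, and that map is recovered from its coordinate at the
origin, an element of the countable set `C(K, ℤ)`. -/
theorem countable_setOf_isFactorOf {K : Type*} [TopologicalSpace K] [CompactSpace K]
    [SecondCountableTopology K] [LocallyCompactSpace K] (T : K ≃ₜ K) :
    {X : Subshift | IsFactorOf X.map T}.Countable := by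
  have hC := countable_continuousMap_int K
  choose φ hφ hsurj hcomm using fun X : {X : Subshift | IsFactorOf X.map T} => X.2
  let F : {X : Subshift | IsFactorOf X.map T} → C(K, ℤ) := fun X =>
    ⟨fun x => (φ X x).1 0, (continuous_apply 0).comp (continuous_subtype_val.comp (hφ X))⟩
  have hF : Function.Injective F := by
    intro X X' h
    have h1 := factorMap_unique (hcomm X) (hcomm X') fun x => congrArg (fun f : C(K, ℤ) => f x) h
    refine Subtype.ext (Subshift.ext_carrier (Set.Subset.antisymm ?_ ?_))
    · intro s hs
      obtain ⟨x, hx⟩ := hsurj X ⟨s, hs⟩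
      have := h1 x
      rw [hx] at this
      rw [show s = _ from this]
      exact (φ X' x).2
    · intro s hs
      obtain ⟨x, hx⟩ := hsurj X' ⟨s, hs⟩
      have := h1 x
      rw [hx] at this
      rw [show s = _ from this.symm]
      exact (φ X x).2
  exact hF.countable

theorem Conjugate.symm {X Y : Type*} [TopologicalSpace X] [TopologicalSpace Y]
    {T : X ≃ₜ X} {T' : Y ≃ₜ Y} : Conjugate T T' → Conjugate T' T := by
  rintro ⟨φ, hφ⟩
  refine ⟨φ.symm, fun y => ?_⟩
  rw [Homeomorph.symm_apply_eq, hφ, φ.apply_symm_apply]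

theorem Conjugate.trans {X Y Z : Type*} [TopologicalSpace X] [TopologicalSpace Y]
    [TopologicalSpace Z] {T : X ≃ₜ X} {T' : Y ≃ₜ Y} {T'' : Z ≃ₜ Z} :
    Conjugate T T' → Conjugate T' T'' → Conjugate T T'' := by
  rintro ⟨φ, hφ⟩ ⟨ψ, hψ⟩
  exact ⟨φ.trans ψ, fun x => by simp [hφ, hψ]⟩

theorem Conjugate.isFactorOf {X Y : Type*} [TopologicalSpace X] [TopologicalSpace Y]
    {T : X ≃ₜ X} {T' : Y ≃ₜ Y} : Conjugate T T' → IsFactorOf T' T :=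
  fun ⟨φ, hφ⟩ => ⟨φ, φ.continuous, φ.surjective, hφ⟩

theorem countable_conj (Y : Subshift) : {X | conj X Y}.Countable :=
  (countable_setOf_isFactorOf Y.map).mono fun _ h => h.symm.isFactorOf

theorem countable_flipConj (Y : Subshift) : {X | flipConj X Y}.Countable :=
  ((countable_setOf_isFactorOf Y.map).union (countable_setOf_isFactorOf Y.map.symm)).mono
    fun _ h => h.imp (fun h => h.symm.isFactorOf) fun h => h.symm.isFactorOf

theorem countable_biFactor (Y : Subshift) : {X | biFactor X Y}.Countable :=
  (countable_setOf_isFactorOf Y.map).mono fun _ h => h.1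

/-! ### Infinite desubstitution by the morphisms `a ↦ c a c̄` -/

/-- The letter at position `r` of the word `c a c̄`. -/
def fill (c : Bool) (r : ℤ) (a : Bool) : Bool := if r = 0 then c else if r = 1 then a else !c

/-- `s = S^k τ(y)` where `τ(a) = c a c̄`. -/
def Rep (c : Bool) (s y : ℤ → Bool) (k : Fin 3) : Prop :=
  ∀ i : ℤ, s i = fill c ((i + (k : ℕ)) % 3) (y ((i + (k : ℕ)) / 3))

theorem Rep.apply {c : Bool} {s y : ℤ → Bool} {k : Fin 3} (h : Rep c s y k) (m r : ℤ)
    (hr : 0 ≤ r) (hr3 : r < 3) : s (3 * m + r - (k : ℕ)) = fill c r (y m) := by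
  rw [h]
  congr 1
  · omega
  · congr 1
    omega

theorem Rep.apply_left {c : Bool} {s y : ℤ → Bool} {k : Fin 3} (h : Rep c s y k) (m : ℤ) :
    s (3 * m - (k : ℕ)) = c := by
  simpa [fill] using h.apply m 0 (by norm_num) (by norm_num)

theorem Rep.apply_mid {c : Bool} {s y : ℤ → Bool} {k : Fin 3} (h : Rep c s y k) (m : ℤ) :
    s (3 * m + 1 - (k : ℕ)) = y m := by
  simpa [fill] using h.apply m 1 (by norm_num) (by norm_num)

theorem Rep.apply_right {c : Bool} {s y : ℤ → Bool} {k : Fin 3} (h : Rep c s y k) (m : ℤ) :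
    s (3 * m + 2 - (k : ℕ)) = !c := by
  simpa [fill] using h.apply m 2 (by norm_num) (by norm_num)

/-- Both letters occur in `s`. -/
def Full (s : ℤ → Bool) : Prop := ∀ b, ∃ i, s i = b

theorem Rep.full {c : Bool} {s y : ℤ → Bool} {k : Fin 3} (h : Rep c s y k) : Full s := by
  intro b
  by_cases hb : b = c
  · exact ⟨_, hb ▸ h.apply_left 0⟩
  · exact ⟨_, (h.apply_right 0).trans (Bool.eq_not.2 hb).symm⟩

theorem Full.not_const {s : ℤ → Bool} (h : Full s) (b : Bool) (hb : ∀ i, s i = b) : False := by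
  obtain ⟨i, hi⟩ := h (!b)
  rw [hb] at hi
  exact Bool.eq_not.1 hi rfl

/-- With different offsets the middle positions of one parse fall on first or last positions of the
other. There the letter is constant, so `y` would be constant. -/
theorem Rep.offset_unique {c c' : Bool} {s y y' : ℤ → Bool} {k k' : Fin 3} (h : Rep c s y k)
    (h' : Rep c' s y' k') (hy : Full y) : k = k' := by
  by_contra hne
  have hk : (k : ℕ) ≠ k' := fun h => hne (Fin.ext h)
  have h1 := k.2
  have h2 := k'.2
  have h3 : ∀ m : ℤ, y m = fill c' ((1 - (k : ℕ) + (k' : ℕ) : ℤ) % 3) (!c') := by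
    intro m
    rw [← h.apply_mid m, h']
    have : (3 * m + 1 - (k : ℕ) + (k' : ℕ) : ℤ) % 3 = (1 - (k : ℕ) + (k' : ℕ) : ℤ) % 3 := by omega
    rw [this]
    have h0 : (1 - (k : ℕ) + (k' : ℕ) : ℤ) % 3 ≠ 1 := by omega
    simp [fill, h0]
  exact hy.not_const _ h3

theorem Rep.unique {c c' : Bool} {s y y' : ℤ → Bool} {k k' : Fin 3} (h : Rep c s y k)
    (h' : Rep c' s y' k') (hy : Full y) : c = c' ∧ k = k' ∧ y = y' := by
  obtain rfl := h.offset_unique h' hy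
  exact ⟨(h.apply_left 0).symm.trans (h'.apply_left 0), rfl,
    funext fun m => (h.apply_mid m).symm.trans (h'.apply_mid m)⟩

/-- The infinite desubstitutions along `x`. -/
def towers (x : ℕ → Bool) : Set ((ℕ → ℤ → Bool) × (ℕ → Fin 3)) :=
  {p | ∀ n, Rep (x n) (p.1 n) (p.1 (n + 1)) (p.2 n)}

/-- The sequences that can be desubstituted infinitely often along `x`. -/
def base (x : ℕ → Bool) : Set (ℤ → Bool) := (fun p : (ℕ → ℤ → Bool) × (ℕ → Fin 3) => p.1 0) '' towers x

/-- The tail of a sequence. -/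
def tail (x : ℕ → Bool) (n : ℕ) : ℕ → Bool := fun m => x (n + m)

theorem mem_base_iff {x : ℕ → Bool} {s : ℤ → Bool} :
    s ∈ base x ↔ ∃ y ∈ base (tail x 1), ∃ k, Rep (x 0) s y k := by
  constructor
  · rintro ⟨p, hp, rfl⟩
    refine ⟨p.1 1, ⟨(fun n => p.1 (n + 1), fun n => p.2 (n + 1)), fun n => ?_, rfl⟩, p.2 0, hp 0⟩
    have := hp (n + 1)
    rwa [show x (n + 1) = tail x 1 n by rw [tail, add_comm]] at this
  · rintro ⟨_, ⟨p, hp, rfl⟩, k, h⟩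
    refine ⟨(fun n => Nat.casesOn n s p.1, fun n => Nat.casesOn n k p.2), fun n => ?_, rfl⟩
    cases n with
    | zero => exact h
    | succ n =>
      have := hp n
      rwa [tail, add_comm] at this

theorem towers_full {x : ℕ → Bool} {p} (hp : p ∈ towers x) (n : ℕ) : Full (p.1 n) := (hp n).full

theorem base_full {x : ℕ → Bool} {s} (hs : s ∈ base x) : Full s := by
  obtain ⟨p, hp, rfl⟩ := hs
  exact towers_full hp 0

theorem towers_unique_succ {x x' : ℕ → Bool} {p q} (hp : p ∈ towers x) (hq : q ∈ towers x') {n : ℕ}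
    (h : p.1 n = q.1 n) : x n = x' n ∧ p.2 n = q.2 n ∧ p.1 (n + 1) = q.1 (n + 1) := by
  have h1 := hp n
  rw [h] at h1
  exact h1.unique (hq n) (towers_full hp _)

theorem towers_unique {x x' : ℕ → Bool} {p q} (hp : p ∈ towers x) (hq : q ∈ towers x') {n : ℕ}
    (h : p.1 n = q.1 n) (m : ℕ) (hm : n ≤ m) : x m = x' m ∧ p.2 m = q.2 m ∧ p.1 m = q.1 m := by
  have h1 : p.1 m = q.1 m := by
    induction m, hm using Nat.le_induction with
    | base => exact h
    | succ m _ ih => exact (towers_unique_succ hp hq ih).2.2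
  exact ⟨(towers_unique_succ hp hq h1).1, (towers_unique_succ hp hq h1).2.1, h1⟩

/-- Unique parsing at each level recovers the letter x n, so the sets `base x` are pairwise
disjoint; this makes the family injective. -/
theorem eq_of_mem_base {x x' : ℕ → Bool} {s} (hs : s ∈ base x) (hs' : s ∈ base x') : x = x' := by
  obtain ⟨p, hp, rfl⟩ := hs
  obtain ⟨q, hq, h⟩ := hs'
  exact funext fun n => (towers_unique hp hq (n := 0) h.symm n n.zero_le).1

theorem towers_injOn (x : ℕ → Bool) :
    Set.InjOn (fun p : (ℕ → ℤ → Bool) × (ℕ → Fin 3) => p.1 0) (towers x) := by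
  intro p hp q hq h
  refine Prod.ext ?_ ?_ <;> funext n
  · exact (towers_unique hp hq (n := 0) h n n.zero_le).2.2
  · exact (towers_unique hp hq (n := 0) h n n.zero_le).2.1

/-! ### Topology of the spaces of desubstitutions -/

/-- Closedness holds jointly in `x`: slices give compactness of `towers x`, and projection to `x`
later gives half of the continuity of `family`. -/
theorem isClosed_total :
    IsClosed {q : (ℕ → Bool) × (ℕ → ℤ → Bool) × (ℕ → Fin 3) | q.2 ∈ towers q.1} := by
  have : {q : (ℕ → Bool) × (ℕ → ℤ → Bool) × (ℕ → Fin 3) | q.2 ∈ towers q.1} =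
      ⋂ (n : ℕ) (i : ℤ), {q | q.2.1 n i = fill (q.1 n) ((i + (q.2.2 n : ℕ)) % 3)
        (q.2.1 (n + 1) ((i + (q.2.2 n : ℕ)) / 3))} := by
    ext q
    simp [towers, Rep]
  rw [this]
  refine isClosed_iInter fun n => isClosed_iInter fun i => isClosed_eq (by fun_prop) ?_
  have key : Continuous fun z : Fin 3 × Bool × (ℤ → Bool) =>
      fill z.2.1 ((i + (z.1 : ℕ)) % 3) (z.2.2 ((i + (z.1 : ℕ)) / 3)) := by
    rw [continuous_prod_of_discrete_left]
    intro k
    have h2 : Continuous fun w : Bool × Bool => fill w.1 ((i + (k : ℕ)) % 3) w.2 :=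
      continuous_of_discreteTopology
    exact h2.comp (f := fun z : Bool × (ℤ → Bool) => (z.1, z.2 ((i + (k : ℕ)) / 3))) (by fun_prop)
  exact key.comp (f := fun q : (ℕ → Bool) × (ℕ → ℤ → Bool) × (ℕ → Fin 3) =>
    (q.2.2 n, q.1 n, q.2.1 (n + 1))) (by fun_prop)

theorem isCompact_towers (x : ℕ → Bool) : IsCompact (towers x) :=
  (isClosed_total.preimage (Continuous.prodMk_right x)).isCompact

theorem isCompact_base (x : ℕ → Bool) : IsCompact (base x) :=
  (isCompact_towers x).image (by fun_prop)

/-! ### Existence of desubstitutions with prescribed addresses -/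

/-- The sequences at all levels with prescribed offsets `k` and letters `a` at the origin. -/
def grow (x : ℕ → Bool) (k : ℕ → Fin 3) (a : ℕ → Bool) (n : ℕ) (i : ℤ) : Bool :=
  if i = 0 then a n else
  -- Passing from i to (i + k) / 3 decreases |i| except at 0 and in the next two cases, where the
  -- position is fixed by division. There the residue is 0 or 2, so the letter of the next level is
  -- not needed.
  if i = 1 ∧ (k n : ℕ) = 2 then x n else
  if i = -1 ∧ (k n : ℕ) = 0 then !x n else
  fill (x n) ((i + (k n : ℕ)) % 3) (grow x k a (n + 1) ((i + (k n : ℕ)) / 3))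
termination_by i.natAbs
decreasing_by
  have := (k n).2
  omega

/-- The hypothesis is the parsing equation at the origin; away from the origin the recursion of
`grow` satisfies the equation by construction. -/
theorem exists_tower {x : ℕ → Bool} (k : ℕ → Fin 3) (a : ℕ → Bool)
    (h : ∀ n, a n = fill (x n) (k n : ℕ) (a (n + 1))) :
    ∃ p ∈ towers x, p.2 = k ∧ ∀ n, p.1 n 0 = a n := by
  have h0 : ∀ n, grow x k a n 0 = a n := fun n => by rw [grow]; simp
  refine ⟨(grow x k a, k), fun n i => ?_, rfl, h0⟩
  have hk := (k n).2
  simp only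
  by_cases hi : i = 0
  · subst hi
    rw [h0, h, zero_add, Int.emod_eq_of_lt (by omega) (by omega),
      Int.ediv_eq_zero_of_lt (by omega) (by omega), h0]
  by_cases hi1 : i = 1 ∧ (k n : ℕ) = 2
  · rw [grow]
    simp [hi1, fill]
  by_cases hi2 : i = -1 ∧ (k n : ℕ) = 0
  · rw [grow]
    simp [hi2, fill]
  rw [grow]
  simp only [hi, hi1, hi2, if_false]

/-- A desubstitution is determined by its offsets and the letters at the origin. -/
theorem tower_eq_of_origin {x : ℕ → Bool} {p q} (hp : p ∈ towers x) (hq : q ∈ towers x)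
    (hk : p.2 = q.2) (h0 : ∀ n, p.1 n 0 = q.1 n 0) : p = q := by
  have key : ∀ (N : ℕ) (n : ℕ) (i : ℤ), i.natAbs ≤ N → p.1 n i = q.1 n i := by
    intro N
    induction N with
    | zero =>
      intro n i hi
      obtain rfl : i = 0 := by omega
      exact h0 n
    | succ N ih =>
      intro n i hi
      have hlt := (q.2 n).2
      by_cases hi0 : i = 0
      · rw [hi0]; exact h0 n
      rw [hp n i, hq n i, hk]
      -- A middle position refers to a position closer to the origin one level up; the other two
      -- residues carry letters dictated by `x`.
      by_cases hi1 : (i + (q.2 n : ℕ)) % 3 = 1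
      · rw [ih (n + 1) _ (by omega)]
      · simp [fill, hi1]
  exact Prod.ext (funext fun n => funext fun i => key _ n i le_rfl) hk

theorem base_nonempty (x : ℕ → Bool) : (base x).Nonempty := by
  obtain ⟨p, hp, -⟩ := exists_tower (x := x) (fun _ => 0) x (fun n => by simp [fill])
  exact ⟨_, p, hp, rfl⟩

/-! ### Minimality and dependence on the index -/

/-- The pairs c b and a c̄ occur inside blocks, and c̄ c at the junction of two blocks. These cover
all four pairs. -/
theorem Rep.two_letters {c : Bool} {s y : ℤ → Bool} {k : Fin 3} (h : Rep c s y k) (hy : Full y)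
    (a b : Bool) : ∃ j, s j = a ∧ s (j + 1) = b := by
  have e1 : ∀ m : ℤ, 3 * m - (k : ℕ) + 1 = 3 * m + 1 - (k : ℕ) := fun m => by ring
  have e2 : ∀ m : ℤ, 3 * m + 1 - (k : ℕ) + 1 = 3 * m + 2 - (k : ℕ) := fun m => by ring
  have e3 : ∀ m : ℤ, 3 * m + 2 - (k : ℕ) + 1 = 3 * (m + 1) - (k : ℕ) := fun m => by ring
  by_cases ha : a = c
  · obtain ⟨m, hm⟩ := hy b
    exact ⟨3 * m - (k : ℕ), by rw [h.apply_left, ha], by rw [e1, h.apply_mid, hm]⟩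
  · have ha' : a = !c := Bool.eq_not.2 ha
    by_cases hb : b = c
    · exact ⟨3 * 0 + 2 - (k : ℕ), by rw [h.apply_right, ha'], by rw [e3, h.apply_left, hb]⟩
    · have hb' : b = !c := Bool.eq_not.2 hb
      obtain ⟨m, hm⟩ := hy a
      exact ⟨3 * m + 1 - (k : ℕ), by rw [h.apply_mid, hm], by rw [e2, h.apply_right, hb']⟩

theorem base_two_letters {x : ℕ → Bool} {s} (hs : s ∈ base x) (a b : Bool) :
    ∃ j, s j = a ∧ s (j + 1) = b := by
  obtain ⟨p, hp, rfl⟩ := hs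
  exact (hp 0).two_letters (towers_full hp 1) a b

/-- Long words of `base x` occur in every element of `base x'` when `x` and `x'` have a long common
prefix. -/
theorem exists_occurrence (n : ℕ) : ∀ {x x' : ℕ → Bool} (_ : ∀ m < n, x m = x' m) {s t : ℤ → Bool}
    (_ : s ∈ base x) (_ : t ∈ base x') (i : ℤ),
    ∃ j : ℤ, ∀ m : ℤ, 0 ≤ m → m ≤ 3 ^ n → s (i + m) = t (j + m) := by
  induction n with
  | zero =>
    intro x x' _ s t _ ht i
    -- Every two-letter word occurs in every element, so no common prefix is needed to start the
    -- induction.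
    obtain ⟨j, h0, h1⟩ := base_two_letters ht (s i) (s (i + 1))
    refine ⟨j, fun m hm hm1 => ?_⟩
    obtain rfl | rfl : m = 0 ∨ m = 1 := by simp at hm1; omega
    · simpa using h0.symm
    · exact h1.symm
  | succ n ih =>
    intro x x' hx s t hs ht i
    obtain ⟨y, hy, k, hk⟩ := mem_base_iff.1 hs
    obtain ⟨z, hz, l, hl⟩ := mem_base_iff.1 ht
    -- A window of 3 ^ (n + 1) + 1 letters meets at most 3 ^ n + 1 consecutive blocks, since ⌊(2 + 3
    -- ^ (n + 1)) / 3⌋ = 3 ^ n. Windows of this length thus reproduce themselves under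
    -- desubstitution.
    obtain ⟨j, hj⟩ := ih (x := tail x 1) (x' := tail x' 1) (fun m hm => hx _ (by omega)) hy hz
      ((i + (k : ℕ)) / 3)
    refine ⟨3 * j + (i + (k : ℕ)) % 3 - (l : ℕ), fun m hm hm1 => ?_⟩
    rw [pow_succ] at hm1
    rw [hk, hl, hx 0 n.succ_pos]
    have h1 : (3 * j + (i + (k : ℕ)) % 3 - (l : ℕ) + m + (l : ℕ)) % 3 = (i + m + (k : ℕ)) % 3 := by
      omega
    have h2 : (i + m + (k : ℕ)) / 3 = (i + (k : ℕ)) / 3 + ((i + (k : ℕ)) % 3 + m) / 3 := by omega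
    have h3 : (3 * j + (i + (k : ℕ)) % 3 - (l : ℕ) + m + (l : ℕ)) / 3
        = j + ((i + (k : ℕ)) % 3 + m) / 3 := by omega
    rw [h1, h2, h3, hj _ (by omega) (by omega)]

/-! ### Shift invariance -/

theorem Rep.shift_of_lt {c : Bool} {s y : ℤ → Bool} {k l : Fin 3} (h : Rep c s y k)
    (hl : (l : ℕ) = k + 1) : Rep c (shift Bool s) y l := by
  intro i
  change s (i + 1) = _
  rw [h, hl]
  push_cast
  rw [add_assoc, add_comm (1 : ℤ)]

theorem Rep.shift_of_eq {c : Bool} {s y : ℤ → Bool} {k : Fin 3} (h : Rep c s y k)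
    (hk : (k : ℕ) = 2) : Rep c (shift Bool s) (shift Bool y) 0 := by
  intro i
  change s (i + 1) = fill _ _ (y (_ + 1))
  rw [h, hk]
  congr 1
  · simp; omega
  · congr 1
    simp; omega

/-- The displacements at all levels induced by a translation by `d`. -/
def displacement (k : ℕ → Fin 3) (d : ℤ) : ℕ → ℤ
  | 0 => d
  | n + 1 => (displacement k d n + (k n : ℕ)) / 3

/-- Division with remainder propagates the translation: displacement plus offset at level `n` equals
three times the displacement at level `n + 1` plus the new offset. -/
theorem translate_mem_base {x : ℕ → Bool} {s} (hs : s ∈ base x) (d : ℤ) :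
    (fun i => s (i + d)) ∈ base x := by
  obtain ⟨p, hp, rfl⟩ := hs
  refine ⟨(fun n i => p.1 n (i + displacement p.2 d n),
    fun n => ⟨((displacement p.2 d n + (p.2 n : ℕ)) % 3).toNat, by omega⟩), fun n i => ?_, rfl⟩
  have h : (((displacement p.2 d n + (p.2 n : ℕ)) % 3).toNat : ℤ) =
    (displacement p.2 d n + (p.2 n : ℕ)) % 3 := Int.toNat_of_nonneg (by omega)
  simp only [displacement, h]
  rw [hp n]
  congr 1
  · omega
  · refine congrArg _ ?_
    omega

theorem shift_mem_base_iff {x : ℕ → Bool} {s : ℤ → Bool} :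
    s ∈ base x ↔ shift Bool s ∈ base x := by
  refine ⟨fun h => translate_mem_base h 1, fun h => ?_⟩
  convert translate_mem_base h (-1) using 2 with i
  simp [shift]

theorem exists_window {A : Type*} [TopologicalSpace A] {U : Set (ℤ → A)} (hU : IsOpen U)
    {s : ℤ → A} (hs : s ∈ U) :
    ∃ N : ℕ, ∀ t : ℤ → A, (∀ i : ℤ, -N ≤ i → i ≤ N → t i = s i) → t ∈ U := by
  obtain ⟨I, u, hu, h⟩ := isOpen_pi_iff.1 hU s hs
  refine ⟨I.sup Int.natAbs, fun t ht => h fun i hi => ?_⟩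
  have : i.natAbs ≤ I.sup Int.natAbs := Finset.le_sup (f := Int.natAbs) hi
  rw [ht i (by omega) (by omega)]
  exact (hu i hi).2

/-- A window of radius `N` has 2N + 1 ≤ 3 ^ (2N) + 1 letters, hence the common prefix of length 2N.
-/
theorem exists_window_occurrence (N : ℕ) {x x' : ℕ → Bool} (hx : ∀ m < 2 * N, x m = x' m)
    {s t : ℤ → Bool} (hs : s ∈ base x) (ht : t ∈ base x') :
    ∃ k : ℤ, ∀ i : ℤ, -N ≤ i → i ≤ N → t (i + k) = s i := by
  obtain ⟨j, hj⟩ := exists_occurrence (2 * N) hx hs ht (-N)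
  have h3 : ((2 * N : ℕ) : ℤ) ≤ 3 ^ (2 * N) := by
    exact_mod_cast (Nat.lt_pow_self (by norm_num : 1 < 3)).le
  push_cast at h3
  refine ⟨j + N, fun i h1 h2 => ?_⟩
  have := hj (i + N) (by omega) (by omega)
  rw [show -(N : ℤ) + (i + N) = i by ring] at this
  rw [this]
  congr 1
  ring

/-- The orbit of every element of `base x` is dense. -/
theorem base_subset_closure_orbit {x : ℕ → Bool} {s t} (hs : s ∈ base x) (ht : t ∈ base x) :
    s ∈ closure (Set.range fun k : ℤ => fun i : ℤ => t (i + k)) := by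
  refine mem_closure_iff.2 fun U hU hsU => ?_
  obtain ⟨N, hN⟩ := exists_window hU hsU
  obtain ⟨k, hk⟩ := exists_window_occurrence N (fun _ _ => rfl) hs ht
  exact ⟨_, hN _ hk, k, rfl⟩

theorem closure_orbit_eq_base {x : ℕ → Bool} {t} (ht : t ∈ base x) :
    closure (Set.range fun k : ℤ => fun i : ℤ => t (i + k)) = base x := by
  refine Set.Subset.antisymm (closure_minimal ?_ (isCompact_base x).isClosed)
    fun s hs => base_subset_closure_orbit hs ht
  rintro _ ⟨k, rfl⟩
  exact translate_mem_base ht k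

/-- Infinite descent on the period: a multiple of 3 yields the period p / 3 one level up, while any
other period moves middle positions to constant ones and makes `y` constant. -/
theorem not_isPeriodicSeq_of_mem_base {x : ℕ → Bool} {s} (hs : s ∈ base x) :
    ¬ IsPeriodicSeq s := by
  rintro ⟨p, hp, h⟩
  induction p using Nat.strong_induction_on generalizing x s with
  | _ p ih =>
    obtain ⟨y, hy, k, hk⟩ := mem_base_iff.1 hs
    by_cases h3 : p % 3 = 0
    · refine ih (p / 3) (by omega) hy (by omega) fun m => ?_
      rw [← hk.apply_mid, ← hk.apply_mid, ← h (3 * m + 1 - (k : ℕ))]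
      congr 1
      push_cast
      omega
    · refine (base_full hy).not_const (fill (x 0) (((1 + p : ℕ) : ℤ) % 3) (!(x 0))) fun m => ?_
      rw [← hk.apply_mid, ← h, hk]
      have h1 : (3 * m + 1 - ((k : ℕ) : ℤ) + (p : ℤ) + ((k : ℕ) : ℤ)) % 3 = ((1 + p : ℕ) : ℤ) % 3 := by
        push_cast; omega
      have h2 : ((1 + p : ℕ) : ℤ) % 3 ≠ 1 := by omega
      rw [h1]
      simp only [fill, h2, if_false]

/-- With all offsets 0, a position of residue 0 or 2 has period 3. A middle position has three times
the period of i / 3 one level up, which is closer to the origin. -/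
theorem exists_isToeplitzSeq (x : ℕ → Bool) : ∃ t ∈ base x, IsToeplitzSeq t := by
  obtain ⟨p, hp, hk, -⟩ := exists_tower (x := x) (fun _ => 0) x (fun n => by simp [fill])
  have h : ∀ n i, p.1 n i = fill (x n) (i % 3) (p.1 (n + 1) (i / 3)) := fun n i => by
    rw [hp n, hk]; simp
  have key : ∀ (N n : ℕ) (i : ℤ), i.natAbs ≤ N →
      ∃ q : ℕ, 1 ≤ q ∧ ∀ k : ℤ, p.1 n (i + k * q) = p.1 n i := by
    intro N
    induction N with
    | zero =>
      intro n i hi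
      obtain rfl : i = 0 := by omega
      refine ⟨3, by norm_num, fun k => ?_⟩
      rw [h, h n 0]
      have : (0 + k * (3 : ℕ) : ℤ) % 3 = 0 := by push_cast; omega
      simp [fill]
    | succ N ih =>
      intro n i hi
      by_cases h1 : i % 3 = 1
      · obtain ⟨q, hq, hq'⟩ := ih (n + 1) (i / 3) (by omega)
        refine ⟨3 * q, by omega, fun k => ?_⟩
        have e : i + k * ((3 * q : ℕ) : ℤ) = i + 3 * (k * q) := by push_cast; ring
        rw [h, h n i, ← hq' k, e]
        congr 1
        · omega
        · refine congrArg _ ?_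
          omega
      · refine ⟨3, by norm_num, fun k => ?_⟩
        rw [h, h n i]
        have : (i + k * (3 : ℕ) : ℤ) % 3 = i % 3 := by push_cast; omega
        simp [fill, h1]
  exact ⟨p.1 0, ⟨p, hp, rfl⟩, fun i => key _ 0 i le_rfl⟩

/-! ### Conjugacy for tail equivalent indices -/

/-- The shift on `base x`. -/
def baseMap (x : ℕ → Bool) : base x ≃ₜ base x := shiftOn (base x) fun _ => shift_mem_base_iff

@[simp]
theorem baseMap_val (x : ℕ → Bool) (s : base x) : (baseMap x s).1 = shift Bool s.1 := rfl

instance (x : ℕ → Bool) : CompactSpace (base x) := isCompact_iff_compactSpace.1 (isCompact_base x)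

/-- `(y, k) ↦ S^k τ(y)`. -/
def spread (x : ℕ → Bool) (q : base (tail x 1) × Fin 3) : base x :=
  ⟨fun i => fill (x 0) ((i + (q.2 : ℕ)) % 3) (q.1.1 ((i + (q.2 : ℕ)) / 3)),
    mem_base_iff.2 ⟨q.1.1, q.1.2, q.2, fun _ => rfl⟩⟩

theorem rep_spread {x : ℕ → Bool} (q : base (tail x 1) × Fin 3) :
    Rep (x 0) (spread x q).1 q.1.1 q.2 := fun _ => rfl

theorem eq_spread {x : ℕ → Bool} {s : base x} {q : base (tail x 1) × Fin 3}
    (h : Rep (x 0) s.1 q.1.1 q.2) : s = spread x q :=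
  Subtype.ext (funext h)

theorem spread_bijective (x : ℕ → Bool) : Function.Bijective (spread x) := by
  constructor
  · intro q q' h
    have h1 := rep_spread q
    rw [h] at h1
    have := h1.unique (rep_spread q') (base_full q.1.2)
    exact Prod.ext (Subtype.ext this.2.2) this.2.1
  · intro s
    obtain ⟨y, hy, k, h⟩ := mem_base_iff.1 s.2
    exact ⟨(⟨y, hy⟩, k), (eq_spread h).symm⟩

theorem continuous_spread (x : ℕ → Bool) : Continuous (spread x) := by
  refine Continuous.subtype_mk (continuous_pi fun i => ?_) _
  rw [continuous_prod_of_discrete_right]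
  intro k
  exact (continuous_of_discreteTopology (f := fill (x 0) ((i + (k : ℕ)) % 3))).comp
    ((continuous_apply ((i + (k : ℕ)) / 3)).comp continuous_subtype_val)

/-- `base x` is a tower of height `3` over `base (tail x 1)`. -/
def spreadHomeo (x : ℕ → Bool) : base (tail x 1) × Fin 3 ≃ₜ base x :=
  Continuous.homeoOfEquivCompactToT2 (f := Equiv.ofBijective _ (spread_bijective x))
    (continuous_spread x)

/-- The shift in the coordinates given by `spread`. -/
def towerMap (x : ℕ → Bool) (q : base x × Fin 3) : base x × Fin 3 :=
  if q.2 = 2 then (baseMap x q.1, 0) else (q.1, q.2 + 1)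

theorem baseMap_spread (x : ℕ → Bool) (q : base (tail x 1) × Fin 3) :
    baseMap x (spread x q) = spread x (towerMap _ q) := by
  refine eq_spread ?_
  rw [towerMap]
  split_ifs with h
  · exact (rep_spread q).shift_of_eq (by rw [h]; rfl)
  · refine (rep_spread q).shift_of_lt ?_
    obtain ⟨y, k⟩ := q
    revert h
    fin_cases k <;> simp

/-- In the coordinates of `spread` the shift is `towerMap`, which does not mention x 0, so a
conjugacy of the bases times the identity on `Fin 3` is a conjugacy of the towers. -/
theorem conjugate_of_tail {x x' : ℕ → Bool}
    (h : Conjugate (baseMap (tail x 1)) (baseMap (tail x' 1))) :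
    Conjugate (baseMap x) (baseMap x') := by
  obtain ⟨φ, hφ⟩ := h
  refine ⟨((spreadHomeo x).symm.trans (φ.prodCongr (Homeomorph.refl _))).trans (spreadHomeo x'),
    fun s => ?_⟩
  obtain ⟨q, rfl⟩ := (spread_bijective x).2 s
  have e : ∀ q, (spreadHomeo x).symm (spread x q) = q := fun q => (spreadHomeo x).symm_apply_apply q
  rw [baseMap_spread]
  simp only [Homeomorph.trans_apply, e]
  change spread x' _ = baseMap x' (spread x' _)
  rw [baseMap_spread]
  congr 1
  simp only [towerMap]
  split_ifs with h1 h2 h2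
  · simp [hφ]
  · exact absurd h1 h2
  · exact absurd h2 h1
  · rfl

theorem conjugate_of_eventuallyEq (n : ℕ) : ∀ {x x' : ℕ → Bool} (_ : ∀ m, n ≤ m → x m = x' m),
    Conjugate (baseMap x) (baseMap x') := by
  induction n with
  | zero =>
    intro x x' h
    obtain rfl : x = x' := funext fun m => h m m.zero_le
    exact ⟨Homeomorph.refl _, fun _ => rfl⟩
  | succ n ih =>
    intro x x' h
    exact conjugate_of_tail (ih fun m hm => h _ (by omega))

/-! ### The family of subshifts -/

/-- Sequences of Booleans as sequences of integers. -/
def encode (s : ℤ → Bool) : ℤ → ℤ := fun i => (s i).toNat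

theorem encode_injective : Function.Injective encode := by
  intro s t h
  funext i
  have := congrFun h i
  simp only [encode] at this
  revert this
  cases s i <;> cases t i <;> simp

theorem continuous_encode : Continuous encode :=
  continuous_pi fun i =>
    (continuous_of_discreteTopology (f := fun b : Bool => (b.toNat : ℤ))).comp (continuous_apply i)

theorem encode_shift (s : ℤ → Bool) : encode (shift Bool s) = shift ℤ (encode s) := rfl

/-- The subshift `base x` over the alphabet `{0, 1} ⊆ ℤ`. -/
def family (x : ℕ → Bool) : Subshift :=
  ⟨⟨⟨encode '' base x, (isCompact_base x).image continuous_encode⟩, (base_nonempty x).image _⟩, by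
    intro s
    change s ∈ encode '' base x ↔ shift ℤ s ∈ encode '' base x
    constructor
    · rintro ⟨t, ht, rfl⟩
      exact ⟨shift Bool t, shift_mem_base_iff.1 ht, rfl⟩
    · rintro ⟨t, ht, h⟩
      refine ⟨(shift Bool).symm t, shift_mem_base_iff.2 (by simpa using ht), ?_⟩
      apply (shift ℤ).injective
      rw [← encode_shift, Homeomorph.apply_symm_apply, h]⟩

theorem family_carrier (x : ℕ → Bool) : (family x).carrier = encode '' base x := rfl

theorem conjugate_family (x : ℕ → Bool) : Conjugate (baseMap x) (family x).map := by
  let e : base x ≃ (family x).carrier := Equiv.Set.image encode (base x) encode_injective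
  have he : Continuous e := (continuous_encode.comp continuous_subtype_val).subtype_mk _
  exact ⟨Continuous.homeoOfEquivCompactToT2 he, fun s => rfl⟩

theorem family_injective : Function.Injective family := by
  intro x x' h
  obtain ⟨s, hs⟩ := base_nonempty x
  have h1 : encode s ∈ encode '' base x' := by
    rw [← family_carrier, ← h]
    exact ⟨s, hs, rfl⟩
  exact eq_of_mem_base hs ((encode_injective.mem_set_image).1 h1)

theorem continuous_family : Continuous family := by
  refine Continuous.subtype_mk (continuous_induced_rng.2 (continuous_generateFrom_iff.2 ?_)) _
  rintro _ (⟨U, hU, rfl⟩ | ⟨U, hU, rfl⟩)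
  -- Subbasic sets of compacta contained in U: the indices that fail form the projection of a
  -- compact set of towers, which is closed.
  · have hU : IsOpen U := hU
    have hc : IsCompact {q : (ℕ → Bool) × (ℕ → ℤ → Bool) × (ℕ → Fin 3) |
        q.2 ∈ towers q.1 ∧ encode (q.2.1 0) ∉ U} :=
      (isClosed_total.inter (hU.isClosed_compl.preimage
        (continuous_encode.comp (by fun_prop :
          Continuous fun q : (ℕ → Bool) × (ℕ → ℤ → Bool) × (ℕ → Fin 3) => q.2.1 0)))).isCompact
    rw [← isClosed_compl_iff]
    convert (hc.image continuous_fst).isClosed using 1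
    ext x
    change ¬ (encode '' base x ⊆ U) ↔ _
    rw [Set.not_subset]
    constructor
    · rintro ⟨_, ⟨_, ⟨p, hp, rfl⟩, rfl⟩, h⟩
      exact ⟨(x, p), ⟨hp, h⟩, rfl⟩
    · rintro ⟨⟨_, p⟩, ⟨hp, h⟩, rfl⟩
      exact ⟨_, ⟨_, ⟨p, hp, rfl⟩, rfl⟩, h⟩
  -- Subbasic sets of compacta meeting U: a window of `s` that forces membership in U recurs in
  -- `base x'` as soon as `x'` shares 2N entries with `x`.
  · have hU : IsOpen U := hU
    rw [isOpen_iff_mem_nhds]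
    rintro x ⟨_, ⟨s, hs, rfl⟩, hsU⟩
    obtain ⟨N, hN⟩ := exists_window (hU.preimage continuous_encode) hsU
    have hopen : IsOpen {x' : ℕ → Bool | ∀ m ∈ Finset.range (2 * N), x m = x' m} := by
      have : {x' : ℕ → Bool | ∀ m ∈ Finset.range (2 * N), x m = x' m} =
          ⋂ m ∈ Finset.range (2 * N), (fun x' : ℕ → Bool => x' m) ⁻¹' {x m} := by
        ext x'
        simp [eq_comm]
      rw [this]
      exact isOpen_biInter_finset fun m _ => (isOpen_discrete _).preimage (continuous_apply m)
    filter_upwards [hopen.mem_nhds fun _ _ => rfl] with x' hx'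
    obtain ⟨t, ht⟩ := base_nonempty x'
    obtain ⟨k, hk⟩ := exists_window_occurrence N (fun m hm => hx' m (Finset.mem_range.2 hm)) hs ht
    exact ⟨_, ⟨_, translate_mem_base ht k, rfl⟩, hN _ hk⟩

theorem isToeplitz_family (x : ℕ → Bool) : IsToeplitz (family x) := by
  obtain ⟨t, ht, hT⟩ := exists_isToeplitzSeq x
  refine ⟨encode t, fun i => ?_, ?_⟩
  · obtain ⟨p, hp, h⟩ := hT i
    exact ⟨p, hp, fun k => by simp only [encode, h k]⟩
  · rw [family_carrier, ← closure_orbit_eq_base ht, 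
      ← continuous_encode.isClosedMap.closure_image_eq_of_continuous continuous_encode,
      ← Set.range_comp]
    rfl

theorem isAperiodic_family (x : ℕ → Bool) : IsAperiodic (family x) := by
  rintro _ ⟨s, hs, rfl⟩ ⟨p, hp, h⟩
  exact not_isPeriodicSeq_of_mem_base hs
    ⟨p, hp, fun i => congrFun (encode_injective (a₁ := fun i => s (i + p)) (funext h)) i⟩

/-! ### Words -/

/-- In `word` the list itself is coerced to integers, through the list monad; here the coercion is
moved to the index. -/
theorem word_eq_map {A : Type*} (s : ℤ → A) (i : ℤ) (m : ℕ) :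
    word s i m = (List.range m).map fun j : ℕ => s (i + j) := by
  have h : (do let a ← List.range m; pure (a : ℤ)) = (List.range m).map fun j : ℕ => (j : ℤ) :=
    List.map_eq_flatMap.symm
  rw [word, h, List.map_map]
  rfl

theorem word_length {A : Type*} (s : ℤ → A) (i : ℤ) (m : ℕ) : (word s i m).length = m := by
  simp [word_eq_map]

theorem word_getElem {A : Type*} (s : ℤ → A) (i : ℤ) (m l : ℕ) (h : l < (word s i m).length) :
    (word s i m)[l] = s (i + l) := by
  simp [word_eq_map]

theorem word_add {A : Type*} (s : ℤ → A) (i : ℤ) (m l : ℕ) :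
    word s i (m + l) = word s i m ++ word s (i + m) l := by
  simp only [word_eq_map, List.range_add, List.map_append, List.map_map]
  congr 2
  funext j
  simp [add_assoc]

theorem word_congr {A : Type*} {s t : ℤ → A} {i j : ℤ} {m : ℕ}
    (h : ∀ l : ℕ, l < m → s (i + l) = t (j + l)) : word s i m = word t j m := by
  rw [word_eq_map, word_eq_map]
  exact List.map_congr_left fun l hl => h l (List.mem_range.1 hl)

theorem word_infix {A : Type*} (s : ℤ → A) {i j : ℤ} {m l : ℕ} (h : j ≤ i) (h' : i + m ≤ j + l) :
    word s i m <:+: word s j l := by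
  refine ⟨word s j (i - j).toNat, word s (i + m) (j + l - (i + m)).toNat, ?_⟩
  have e1 : i = j + (i - j).toNat := by omega
  have e2 : l = (i - j).toNat + m + (j + l - (i + m)).toNat := by omega
  conv_rhs => rw [e2, word_add, word_add]
  congr 2
  · rw [← e1]
  · push_cast
    omega

theorem exists_of_word_infix {A : Type*} {s t : ℤ → A} {i j : ℤ} {m l : ℕ}
    (h : word s i m <:+: word t j l) : ∃ d : ℤ, ∀ r : ℕ, r < m → s (i + r) = t (d + r) := by
  obtain ⟨u, v, h⟩ := h
  refine ⟨j + u.length, fun r hr => ?_⟩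
  have hl : u.length + m + v.length = l := by
    simpa [word_length, add_assoc] using congrArg List.length h
  have h1 : (u ++ word s i m ++ v)[u.length + r]? = (word t j l)[u.length + r]? := by rw [h]
  rw [List.append_assoc, List.getElem?_append_right (by omega), Nat.add_sub_cancel_left,
    List.getElem?_append_left (by rw [word_length]; exact hr),
    List.getElem?_eq_getElem (by rw [word_length]; exact hr),
    List.getElem?_eq_getElem (by rw [word_length]; omega), word_getElem, word_getElem] at h1
  rw [Option.some.inj h1]
  congr 1
  push_cast
  ring

/-! ### The directive sequence -/

/-- The directive sequence of the morphisms `a ↦ c a c̄` with `c = x n`. -/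
abbrev directive (x : ℕ → Bool) : DirectiveSequence where
  alphabet _ := Bool
  finite_alphabet _ := inferInstance
  mor n a := [x n, a, !x n]
  nonerasing _ _ := List.cons_ne_nil _ _

/-- The image of a letter under the composition of the first `N` morphisms. -/
def block (x : ℕ → Bool) : ℕ → Bool → List Bool
  | 0, a => [a]
  | N + 1, a => block x N (x N) ++ (block x N a ++ block x N (!x N))

theorem directive_comp (x : ℕ → Bool) (n N : ℕ) (a : Bool) :
    (directive x).comp n N a = block (tail x n) N a := by
  induction N generalizing a with
  | zero => rfl
  | succ N ih =>
    change List.flatMap ((directive x).comp n N) [x (n + N), a, !x (n + N)] = _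
    simp only [List.flatMap_cons, List.flatMap_nil, List.append_nil, block, ih]
    rfl

/-- The position at level `0` of the origin of level `N`, up to sign. -/
def offset (k : ℕ → Fin 3) : ℕ → ℤ
  | 0 => 0
  | N + 1 => offset k N + 3 ^ N * (k N : ℕ)

/-- A letter at level `N` expands to a block of length 3 ^ N, and three consecutive such blocks,
spelled by the parse at level `N`, form the block of the next level. -/
theorem word_tower {x : ℕ → Bool} {p} (hp : p ∈ towers x) (N : ℕ) (m : ℤ) :
    word (p.1 0) (3 ^ N * m - offset p.2 N) (3 ^ N) = block x N (p.1 N m) := by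
  induction N generalizing m with
  | zero => simp [word, block, offset]
  | succ N ih =>
    have h0 := ih (3 * m - (p.2 N : ℕ))
    have h1 := ih (3 * m + 1 - (p.2 N : ℕ))
    have h2 := ih (3 * m + 2 - (p.2 N : ℕ))
    rw [(hp N).apply_left] at h0
    rw [(hp N).apply_mid] at h1
    rw [(hp N).apply_right] at h2
    rw [block, ← h0, ← h1, ← h2, show 3 ^ (N + 1) = 3 ^ N + (3 ^ N + 3 ^ N) by ring, word_add, word_add, offset]
    congr 2
    · ring
    · congr 1
      push_cast
      ring
    · congr 1
      push_cast
      ring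

/-- With all offsets 1 the origin is the centre of its block at every level, so these blocks exhaust
ℤ in both directions. -/
theorem offset_one (N : ℕ) : 2 * offset (fun _ => 1) N + 1 = 3 ^ N := by
  induction N with
  | zero => simp [offset]
  | succ N ih =>
    simp only [offset, Fin.val_one, Nat.cast_one, mul_one, pow_succ]
    linarith

theorem mem_level_iff (x : ℕ → Bool) (n : ℕ) (s : ℤ → Bool) :
    s ∈ (directive x).level n ↔ s ∈ base (tail x n) := by
  constructor
  · intro h
    rw [← (isCompact_base _).isClosed.closure_eq, mem_closure_iff]
    intro U hU hs
    obtain ⟨N, hN⟩ := exists_window hU hs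
    obtain ⟨k, a, hka⟩ := h (-N) (2 * N + 1)
    rw [directive_comp] at hka
    obtain ⟨_, p, hp, -⟩ := base_nonempty (tail x n)
    -- Both letters occur at level k + 1 of any tower, so the block of `a` is a subword of its
    -- bottom sequence; `s` is then a limit of translates of that sequence.
    obtain ⟨m, hm⟩ := towers_full hp (k + 1) a
    rw [← hm, ← word_tower hp] at hka
    obtain ⟨d, hd⟩ := exists_of_word_infix hka
    refine ⟨_, hN _ fun i h1 h2 => ?_, translate_mem_base ⟨p, hp, rfl⟩ (d + N)⟩
    have := hd (i + N).toNat (by omega)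
    rw [Int.toNat_of_nonneg (by omega), show -(N : ℤ) + (i + N) = i by ring] at this
    rw [this]
    congr 1
    ring
  · intro hs i m
    obtain ⟨p, hp, hk, -⟩ := exists_tower (x := tail x n) (fun _ => 1) (fun _ => true)
      (fun n => by simp [fill])
    obtain ⟨j, hj⟩ := exists_occurrence m (fun _ _ => rfl) hs ⟨p, hp, rfl⟩ i
    have h3 : (m : ℤ) ≤ 3 ^ m := by exact_mod_cast (Nat.lt_pow_self (by norm_num : 1 < 3)).le
    have hw : word s i m = word (p.1 0) j m :=
      word_congr fun l hl => hj l (by omega) (by omega)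
    -- The central block has radius (3 ^ N - 1) / 2, which exceeds |j| + m because N < 3 ^ N. The
    -- summand 1 matches the positive number of morphisms required in `language`.
    set N := 2 * (j.natAbs + m) + 1 with hNdef
    have hN : (N : ℤ) < 3 ^ N := by exact_mod_cast Nat.lt_pow_self (by norm_num : 1 < 3)
    have ho := offset_one N
    refine ⟨2 * (j.natAbs + m), p.1 N 0, ?_⟩
    change word s i m <:+: (directive x).comp n N (p.1 N 0)
    rw [directive_comp, ← word_tower hp, hw, hk]
    refine word_infix _ ?_ ?_
    · omega
    · push_cast
      omega

theorem directive_constantLength (x : ℕ → Bool) : (directive x).ConstantLength := fun _ _ _ => rfl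

theorem directive_proper (x : ℕ → Bool) : (directive x).Proper :=
  fun n => ⟨x n, !x n, fun _ => ⟨rfl, rfl⟩⟩

theorem directive_primitive (x : ℕ → Bool) : (directive x).Primitive := by
  refine fun n => ⟨1, one_pos, fun a b => ?_⟩
  rw [directive_comp]
  cases b <;> cases h : tail x n 0 <;> simp [block, h]

theorem directive_alphabetRank (x : ℕ → Bool) : (directive x).alphabetRank ≤ (2 : ℕ) := by
  simp [DirectiveSequence.alphabetRank]

theorem cutPoint_of_const {A B : Type*} (σ : A → List B) (y : ℤ → A) {l : ℕ}
    (h : ∀ a, (σ a).length = l) (i : ℤ) : cutPoint σ y i = l * i := by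
  simp only [cutPoint, h, Finset.sum_const, Int.card_Ico, nsmul_eq_mul]
  rcases le_total 0 i with hi | hi
  · rw [sub_zero, Int.toNat_of_nonneg hi, Int.toNat_of_nonpos (by omega)]
    simp [mul_comm]
  · rw [sub_zero, Int.toNat_of_nonpos hi, Int.toNat_of_nonneg (by omega)]
    simp [mul_comm]

theorem IsCenteredRep.rep {c : Bool} {s y : ℤ → Bool} {k : ℕ}
    (h : IsCenteredRep (fun a => [c, a, !c]) s y k) : ∃ hk : k < 3, Rep c s y ⟨k, hk⟩ := by
  obtain ⟨hk, h⟩ := h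
  refine ⟨hk, fun i => ?_⟩
  have h1 := h ((i + k) / 3) ((i + k) % 3).toNat (by simp only [List.length_cons, List.length_nil]; omega)
  rw [cutPoint_of_const _ _ (l := 3) (fun _ => rfl), Int.toNat_of_nonneg (by omega),
    show ((3 : ℕ) : ℤ) * ((i + k) / 3) + (i + k) % 3 - k = i by push_cast; omega] at h1
  rw [h1]
  simp only
  obtain h2 | h2 | h2 : (i + k) % 3 = 0 ∨ (i + k) % 3 = 1 ∨ (i + k) % 3 = 2 := by omega
  all_goals simp [fill, h2]

theorem directive_recognizable (x : ℕ → Bool) : (directive x).Recognizable := by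
  intro n s y y' k k' hy _ h h'
  obtain ⟨hk, h⟩ := IsCenteredRep.rep h
  obtain ⟨hk', h'⟩ := IsCenteredRep.rep h'
  have := h.unique h' (base_full ((mem_level_iff x (n + 1) y).1 hy))
  exact ⟨this.2.2, by simpa using this.2.1⟩

theorem conjugate_directive (x : ℕ → Bool) : Conjugate (baseMap x) (directive x).map := by
  have h : ∀ s : ℤ → Bool, s ∈ base x ↔ s ∈ (directive x).level 0 := fun s => by
    rw [mem_level_iff, show tail x 0 = x from funext fun m => congrArg x (Nat.zero_add m)]
  have : DiscreteTopology ((directive x).alphabet 0) := ⟨rfl⟩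
  let e : base x ≃ (directive x).level 0 := Equiv.subtypeEquivRight h
  have he : Continuous e := Continuous.subtype_mk (continuous_pi fun i =>
    (continuous_of_discreteTopology (α := Bool) (f := fun b => b)).comp
      ((continuous_apply i).comp continuous_subtype_val)) _
  exact ⟨Continuous.homeoOfEquivCompactToT2 he, fun s => rfl⟩

theorem isStrongToeplitz_family (x : ℕ → Bool) : IsStrongToeplitz 2 (family x) :=
  ⟨directive x, directive_constantLength x, directive_primitive x, directive_proper x,
    directive_recognizable x, directive_alphabetRank x,
    (conjugate_family x).symm.trans (conjugate_directive x)⟩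

/-! ### Aperiodic subshifts have topological rank at least two -/

namespace OrderedBratteliDiagram

variable {B : OrderedBratteliDiagram}

theorem eq_of_isMin {n : ℕ} {e f : B.E n} (he : IsMin e) (hf : IsMin f)
    (h : B.range n e = B.range n f) : e = f := by
  rcases (B.comparable_iff n e f).2 h with h1 | h1
  · exact le_antisymm h1 (hf h1)
  · exact le_antisymm (he h1) h1

theorem eq_of_covBy {n : ℕ} {e f f' : B.E n} (h : e ⋖ f) (h' : e ⋖ f') : f = f' := by
  have h1 := (B.comparable_iff n e f).1 (Or.inl h.le)
  have h2 := (B.comparable_iff n e f').1 (Or.inl h'.le)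
  rcases (B.comparable_iff n f f').2 (h1.symm.trans h2) with h3 | h3
  · exact (h'.eq_or_eq h.le h3).resolve_left h.ne'
  · exact ((h.eq_or_eq h'.le h3).resolve_left h'.ne').symm

theorem eq_of_isMin_below {p q : B.PathSpace} (k : ℕ) (hp : ∀ j < k, IsMin (p.1 j))
    (hq : ∀ j < k, IsMin (q.1 j)) (h : B.source k (p.1 k) = B.source k (q.1 k)) :
    ∀ j < k, p.1 j = q.1 j := by
  induction k with
  | zero => exact fun j hj => absurd hj j.not_lt_zero
  | succ k ih =>
    have h1 : p.1 k = q.1 k := eq_of_isMin (hp k k.lt_succ_self) (hq k k.lt_succ_self)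
      (by rw [p.2, q.2, h])
    intro j hj
    rcases Nat.lt_succ_iff_lt_or_eq.1 hj with hj | rfl
    · exact ih (fun j hj => hp j (by omega)) (fun j hj => hq j (by omega)) (by rw [h1]) j hj
    · exact h1

theorem IsVershikMap.isMin_of_isMax {T : B.PathSpace → B.PathSpace} (hT : B.IsVershikMap T)
    {p : B.PathSpace} {n : ℕ} (h : ∀ j < n, IsMax (p.1 j)) : ∀ j < n, IsMin ((T p).1 j) := by
  classical
  intro j hj
  by_cases hp : ∀ m, IsMax (p.1 m)
  · exact hT.1 p hp j
  · push Not at hp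
    have h1 : n ≤ Nat.find hp := by
      by_contra! hlt
      exact Nat.find_spec hp (h _ hlt)
    exact (hT.2 p (Nat.find hp) (fun m hm => not_not.1 (Nat.find_min hp hm))
      (Nat.find_spec hp)).2.1 j (by omega)

/-- If there is a single vertex at level `n`, then the first `n` edges of `T p` depend only on the
first `n` edges of `p`. -/
theorem IsVershikMap.prefix_eq {T : B.PathSpace → B.PathSpace} (hT : B.IsVershikMap T) {n : ℕ}
    [Subsingleton (B.V n)] {p q : B.PathSpace} (h : ∀ j < n, p.1 j = q.1 j) :
    ∀ j < n, (T p).1 j = (T q).1 j := by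
  classical
  by_cases hp : ∀ j < n, IsMax (p.1 j)
  · have hq : ∀ j < n, IsMax (q.1 j) := fun j hj => h j hj ▸ hp j hj
    exact eq_of_isMin_below n (hT.isMin_of_isMax hp) (hT.isMin_of_isMax hq) (Subsingleton.elim _ _)
  · push Not at hp
    obtain ⟨hkn, hk⟩ := Nat.find_spec hp
    have hlt : ∀ j < Nat.find hp, IsMax (p.1 j) := fun j hj => by
      have := Nat.find_min hp hj
      push Not at this
      exact this (by omega)
    set k := Nat.find hp
    obtain ⟨p1, p2, p3⟩ := hT.2 p k hlt hk
    obtain ⟨q1, q2, q3⟩ := hT.2 q k (fun j hj => h j (by omega) ▸ hlt j hj) (h k hkn ▸ hk)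
    rw [← h k hkn] at q1
    have hkk := eq_of_covBy p1 q1
    intro j hj
    rcases lt_trichotomy j k with hjk | rfl | hjk
    · exact eq_of_isMin_below k p2 q2 (by rw [hkk]) j hjk
    · exact hkk
    · rw [p3 j hjk, q3 j hjk, h j hj]

/-- By `prefix_eq` the map acts on the finite set of prefixes of length `n`; it acts surjectively,
hence injectively. -/
theorem IsVershikMap.prefix_eq_iff {T : B.PathSpace ≃ₜ B.PathSpace} (hT : B.IsVershikMap T) {n : ℕ}
    [Subsingleton (B.V n)] {p q : B.PathSpace} :
    (∀ j < n, (T p).1 j = (T q).1 j) ↔ ∀ j < n, p.1 j = q.1 j := by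
  refine ⟨fun h => ?_, hT.prefix_eq⟩
  have := B.finite_E
  let π : B.PathSpace → ∀ j : Fin n, B.E j := fun p j => p.1 j
  have hπ : ∀ {p q}, π p = π q ↔ ∀ j < n, p.1 j = q.1 j := fun {p q} =>
    ⟨fun h j hj => congrFun h ⟨j, hj⟩, fun h => funext fun j => h j j.2⟩
  let F : Set.range π → Set.range π := fun u => ⟨π (T u.2.choose), _, rfl⟩
  have hF : ∀ p, F ⟨π p, p, rfl⟩ = ⟨π (T p), _, rfl⟩ := fun p =>
    Subtype.ext (hπ.2 (hT.prefix_eq (hπ.1 (Set.mem_range_self (f := π) p).choose_spec)))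
  have hsurj : Function.Surjective F := by
    rintro ⟨_, p, rfl⟩
    refine ⟨⟨π (T.symm p), _, rfl⟩, ?_⟩
    rw [hF]
    simp
  have hinj := Finite.injective_iff_surjective.2 hsurj
  have h1 : F ⟨π p, p, rfl⟩ = F ⟨π q, q, rfl⟩ := by
    rw [hF, hF]
    exact Subtype.ext (hπ.2 h)
  exact hπ.1 (congrArg Subtype.val (hinj h1))

instance (n : ℕ) : DiscreteTopology (B.E n) := ⟨rfl⟩

/-- A locally constant function on a compact path space depends on finitely many edges. -/
theorem exists_prefix_of_continuous [CompactSpace B.PathSpace] {g : B.PathSpace → ℤ}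
    (hg : Continuous g) : ∃ N, ∀ p q : B.PathSpace, (∀ j < N, p.1 j = q.1 j) → g p = g q := by
  have h1 : ∀ p : B.PathSpace, ∃ N, ∀ q : B.PathSpace, (∀ j < N, p.1 j = q.1 j) → g p = g q := by
    intro p
    obtain ⟨U, hU, hUg⟩ := isOpen_induced_iff.1 ((isOpen_discrete {g p}).preimage hg)
    have hpU : p.1 ∈ U := by
      have : p ∈ g ⁻¹' {g p} := rfl
      rwa [← hUg] at this
    obtain ⟨I, u, hu, h⟩ := isOpen_pi_iff.1 hU p.1 hpU
    refine ⟨I.sup id + 1, fun q hq => ?_⟩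
    have : q ∈ g ⁻¹' {g p} := by
      rw [← hUg]
      refine h fun i hi => ?_
      have hi' : i ≤ I.sup id := Finset.le_sup (f := id) hi
      rw [← hq i (by omega)]
      exact (hu i hi).2
    exact Eq.symm this
  choose N hN using h1
  have hopen : ∀ p : B.PathSpace, {q : B.PathSpace | ∀ j ∈ Finset.range (N p), p.1 j = q.1 j} ∈ 𝓝 p := by
    intro p
    refine IsOpen.mem_nhds ?_ fun _ _ => rfl
    have : {q : B.PathSpace | ∀ j ∈ Finset.range (N p), p.1 j = q.1 j} =
        ⋂ j ∈ Finset.range (N p), (fun q : B.PathSpace => q.1 j) ⁻¹' {p.1 j} := by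
      ext q
      simp [eq_comm]
    rw [this]
    exact isOpen_biInter_finset fun j _ =>
      (isOpen_discrete _).preimage ((continuous_apply j).comp continuous_subtype_val)
  obtain ⟨t, ht⟩ := CompactSpace.elim_nhds_subcover _ hopen
  refine ⟨t.sup N, fun q q' h => ?_⟩
  have hq : q ∈ (⊤ : Set B.PathSpace) := trivial
  rw [← ht] at hq
  obtain ⟨p, hp, hpq⟩ := Set.mem_iUnion₂.1 hq
  have hle : N p ≤ t.sup N := Finset.le_sup hp
  rw [← hN p q fun j hj => hpq j (Finset.mem_range.2 hj), ← hN p q' fun j hj =>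
    (hpq j (Finset.mem_range.2 hj)).trans (h j (by omega))]

end OrderedBratteliDiagram

/-- At a level with a single vertex the Vershik map permutes the finitely many prefixes. If the
prefix also determines the coordinate at the origin, it determines the whole sequence, and every
orbit is periodic. -/
theorem two_le_of_hasBVRepresentation {X : Subshift} (hX : IsAperiodic X) {K : ℕ∞}
    (h : HasBVRepresentation X.map K) : 2 ≤ K := by
  obtain ⟨B, -, -, rfl, T, hT, φ, hφ⟩ := h
  by_contra! hlt
  have hcomp : CompactSpace B.PathSpace := φ.compactSpace
  obtain ⟨N, hN⟩ := B.exists_prefix_of_continuous (g := fun p => (φ.symm p).1 0)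
    ((continuous_apply 0).comp (continuous_subtype_val.comp φ.symm.continuous))
  -- A liminf below 2 gives levels with at most one vertex arbitrarily far out, in particular beyond
  -- the `N` edges that decide the coordinate at 0.
  obtain ⟨n, hn, hNn⟩ :=
    ((frequently_lt_of_liminf_lt (by isBoundedDefault) hlt).and_eventually (eventually_ge_atTop N)).exists
  have := B.finite_V n
  have : Subsingleton (B.V n) := by
    refine Finite.card_le_one_iff_subsingleton.1 ?_
    have : Nat.card (B.V n) < 2 := by exact_mod_cast hn
    omega
  have hψ : ∀ p, φ.symm (T p) = X.map (φ.symm p) := fun p => by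
    rw [Homeomorph.symm_apply_eq, hφ, φ.apply_symm_apply]
  have key : ∀ (i : ℤ) (p q : B.PathSpace), (∀ j < n, p.1 j = q.1 j) →
      (φ.symm p).1 i = (φ.symm q).1 i := by
    intro i
    induction i using Int.induction_on with
    | zero => exact fun p q h => hN p q fun j hj => h j (by omega)
    | succ i ih =>
      intro p q h
      have := ih (T p) (T q) (hT.prefix_eq h)
      rwa [hψ, hψ, X.map_apply, X.map_apply] at this
    | pred i ih =>
      intro p q h
      have := ih (T.symm p) (T.symm q) (hT.prefix_eq_iff.1 (by simpa using h))
      rwa [map_symm_of_comm hψ, map_symm_of_comm hψ, X.map_symm_apply, X.map_symm_apply] at this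
  have hiter : ∀ (m : ℕ) (p : B.PathSpace) (i : ℤ),
      (φ.symm (T^[m] p)).1 i = (φ.symm p).1 (i + m) := by
    intro m
    induction m with
    | zero => simp
    | succ m ih =>
      intro p i
      rw [Function.iterate_succ_apply, ih, hψ, X.map_apply]
      exact congrArg _ (by push_cast; ring)
  have := B.finite_E
  obtain ⟨x₀⟩ : Nonempty X.carrier := X.1.nonempty.to_subtype
  -- Pigeonhole: two iterates share the prefix of length `n`, and the difference of their times is a
  -- period.
  obtain ⟨a, b, hab, h⟩ := Finite.exists_ne_map_eq_of_infinite
    fun (m : ℕ) (j : Fin n) => (T^[m] (φ x₀)).1 j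
  wlog hlt' : a < b generalizing a b
  · exact this b a hab.symm h.symm (by omega)
  have hper : ∀ i, (φ.symm (T^[a] (φ x₀))).1 i = (φ.symm (T^[b] (φ x₀))).1 i := fun i =>
    key i _ _ fun j hj => congrFun h ⟨j, hj⟩
  refine hX x₀.1 x₀.2 ⟨b - a, by omega, fun i => ?_⟩
  have h1 := hper (i - a)
  rw [hiter, hiter, φ.symm_apply_apply] at h1
  rw [show i + ((b - a : ℕ) : ℤ) = i - a + b by omega, ← h1]
  exact congrArg _ (by ring)

/-! ### A Bratteli–Vershik representation of rank two -/

theorem fill_surjective (c a : Bool) (b : Bool) : ∃ r : Fin 3, fill c (r : ℕ) a = b := by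
  by_cases h : b = c
  · exact ⟨0, by simp [fill, h]⟩
  · exact ⟨2, by simp [fill, Bool.eq_not.2 h]⟩

/-- The vertices of the diagram: a root and two vertices at each later level. -/
def DiagramVertex : ℕ → Type
  | 0 => Unit
  | _ + 1 => Bool

/-- The source of the edge `(a, r)`: the letter at position `r` of the image of `a`. -/
def diagramSource (x : ℕ → Bool) : ∀ n, Bool × Fin 3 → DiagramVertex n
  -- The letter at level 0 is not recorded: it is determined by x 0, the position and the letter at
  -- level 1.
  | 0, _ => ()
  | n + 1, e => fill (x (n + 1)) ((e.2 : ℕ) : ℤ) e.1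

theorem exists_diagramSource_eq (x : ℕ → Bool) (n : ℕ) (u : DiagramVertex n) (a : Bool) :
    ∃ r, diagramSource x n (a, r) = u := by
  cases n with
  | zero => exact ⟨0, rfl⟩
  | succ n => exact fill_surjective _ _ _

/-- Edges with the same range are ordered by position. -/
@[reducible]
def edgeOrder : PartialOrder (Bool × Fin 3) where
  le e f := e.1 = f.1 ∧ e.2 ≤ f.2
  lt e f := (e.1 = f.1 ∧ e.2 ≤ f.2) ∧ ¬ (f.1 = e.1 ∧ f.2 ≤ e.2)
  lt_iff_le_not_ge _ _ := Iff.rfl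
  le_refl _ := ⟨rfl, le_rfl⟩
  le_trans _ _ _ h h' := ⟨h.1.trans h'.1, h.2.trans h'.2⟩
  le_antisymm _ _ h h' := Prod.ext h.1 (le_antisymm h.2 h'.2)

/-- The ordered Bratteli diagram of the directive sequence indexed by `x`. -/
def diagram (x : ℕ → Bool) : OrderedBratteliDiagram where
  V := DiagramVertex
  E _ := Bool × Fin 3
  finite_V n := by cases n <;> (unfold DiagramVertex; infer_instance)
  finite_E _ := inferInstance
  card_V_zero := Nat.card_unique (α := Unit)
  source := diagramSource x
  range _ e := e.1
  source_surjective n u := (exists_diagramSource_eq x n u true).imp' _ fun _ h => h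
  range_surjective _ a := ⟨(a, 0), rfl⟩
  order _ := edgeOrder
  comparable_iff n e f := by
    change (e.1 = f.1 ∧ e.2 ≤ f.2) ∨ (f.1 = e.1 ∧ f.2 ≤ e.2) ↔ e.1 = f.1
    constructor
    · rintro (h | h)
      exacts [h.1, h.1.symm]
    · intro h
      exact (le_total e.2 f.2).imp (fun h' => ⟨h, h'⟩) fun h' => ⟨h.symm, h'⟩

theorem diagram_le_iff {x : ℕ → Bool} {n : ℕ} {e f : (diagram x).E n} :
    e ≤ f ↔ @Prod.fst Bool (Fin 3) e = @Prod.fst Bool (Fin 3) f ∧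
      @Prod.snd Bool (Fin 3) e ≤ @Prod.snd Bool (Fin 3) f := Iff.rfl

theorem diagram_isMax_iff {x : ℕ → Bool} {n : ℕ} {e : (diagram x).E n} :
    IsMax e ↔ @Prod.snd Bool (Fin 3) e = 2 := by
  constructor
  · intro h
    have := h (b := (@Prod.fst Bool (Fin 3) e, (2 : Fin 3))) (diagram_le_iff.2 ⟨rfl, Fin.le_last _⟩)
    exact le_antisymm (Fin.le_last _) (diagram_le_iff.1 this).2
  · intro h f hf
    exact diagram_le_iff.2 ⟨(diagram_le_iff.1 hf).1.symm, h ▸ Fin.le_last _⟩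

theorem diagram_isMin_iff {x : ℕ → Bool} {n : ℕ} {e : (diagram x).E n} :
    IsMin e ↔ @Prod.snd Bool (Fin 3) e = 0 := by
  constructor
  · intro h
    have := h (b := (@Prod.fst Bool (Fin 3) e, (0 : Fin 3))) (diagram_le_iff.2 ⟨rfl, Fin.zero_le _⟩)
    exact le_antisymm (diagram_le_iff.1 this).2 (Fin.zero_le _)
  · intro h f hf
    exact diagram_le_iff.2 ⟨(diagram_le_iff.1 hf).1.symm, h ▸ Fin.zero_le _⟩

theorem diagram_covBy {x : ℕ → Bool} {n : ℕ} {a : Bool} {k l : Fin 3} (h : (l : ℕ) = k + 1) :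
    (show (diagram x).E n from (a, k)) ⋖ (show (diagram x).E n from (a, l)) := by
  refine ⟨lt_of_le_not_ge (diagram_le_iff.2 ⟨rfl, Fin.le_def.2 (by simp [h])⟩) fun h' => ?_, ?_⟩
  · have := Fin.le_def.1 (diagram_le_iff.1 h').2
    simp only [h] at this
    omega
  · intro f h1 h2
    have e1 := diagram_le_iff.1 h1.le
    have e2 := diagram_le_iff.1 h2.le
    have e3 : ¬ @Prod.snd Bool (Fin 3) f ≤ k := fun h =>
      h1.not_ge (diagram_le_iff.2 ⟨e1.1.symm, h⟩)
    have e4 : ¬ l ≤ @Prod.snd Bool (Fin 3) f := fun h =>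
      h2.not_ge (diagram_le_iff.2 ⟨e2.1.symm, h⟩)
    rw [Fin.le_def] at e3 e4
    omega

theorem diagram_simple (x : ℕ → Bool) : (diagram x).Simple := by
  refine fun n => ⟨1, one_pos, fun u v => ?_⟩
  obtain ⟨r, hr⟩ := exists_diagramSource_eq x n u v
  exact ⟨(v, r), rfl, hr.symm⟩

theorem diagram_rank (x : ℕ → Bool) : (diagram x).rank = 2 := by
  have h : ∀ᶠ n in atTop, (Nat.card ((diagram x).V n) : ℕ∞) = 2 := by
    filter_upwards [eventually_ge_atTop 1] with n hn
    obtain ⟨n, rfl⟩ := Nat.exists_eq_add_of_le' hn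
    change ((Nat.card Bool : ℕ) : ℕ∞) = 2
    simp
  rw [OrderedBratteliDiagram.rank, liminf_congr h, liminf_const]

/-- The path of offsets and letters at the origin. -/
def towerPath (x : ℕ → Bool) (p : towers x) : (diagram x).PathSpace :=
  ⟨fun n => (p.1.1 (n + 1) 0, p.1.2 n), fun n => by
    have h := p.2 (n + 1) 0
    have hk := (p.1.2 (n + 1)).2
    rw [zero_add, Int.emod_eq_of_lt (by omega) (by omega),
      Int.ediv_eq_zero_of_lt (by omega) (by omega)] at h
    exact h⟩

theorem tower_origin {x : ℕ → Bool} {p} (hp : p ∈ towers x) (n : ℕ) :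
    p.1 n 0 = fill (x n) (p.2 n : ℕ) (p.1 (n + 1) 0) := by
  have h := hp n 0
  have hk := (p.2 n).2
  rwa [zero_add, Int.emod_eq_of_lt (by omega) (by omega),
    Int.ediv_eq_zero_of_lt (by omega) (by omega)] at h

/-- A tower is determined by its offsets and origin letters, and compatible data are always
realised. Compatibility is exactly the matching of ranges and sources along a path. -/
theorem towerPath_bijective (x : ℕ → Bool) : Function.Bijective (towerPath x) := by
  constructor
  · intro p q h
    have h1 : ∀ n, (p.1.1 (n + 1) 0, p.1.2 n) = (q.1.1 (n + 1) 0, q.1.2 n) := fun n =>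
      congrFun (congrArg Subtype.val h) n
    have hk : p.1.2 = q.1.2 := funext fun n => (Prod.ext_iff.1 (h1 n)).2
    have h2 : ∀ n, p.1.1 (n + 1) 0 = q.1.1 (n + 1) 0 := fun n => (Prod.ext_iff.1 (h1 n)).1
    exact Subtype.ext (tower_eq_of_origin p.2 q.2 hk fun n => by
      rw [tower_origin p.2, tower_origin q.2, h2, hk])
  · intro e
    let f : ℕ → Bool × Fin 3 := e.1
    have hf : ∀ n, (f n).1 = fill (x (n + 1)) ((f (n + 1)).2 : ℕ) (f (n + 1)).1 := e.2
    obtain ⟨p, hp, hk, ha⟩ := exists_tower (x := x) (fun n => (f n).2)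
      (fun n => Nat.casesOn n (fill (x 0) ((f 0).2 : ℕ) (f 0).1) fun n => (f n).1) (by
        intro n
        cases n with
        | zero => rfl
        | succ n => exact hf n)
    refine ⟨⟨p, hp⟩, Subtype.ext (funext fun n => ?_)⟩
    exact Prod.ext (ha (n + 1)) (congrFun hk n)

theorem continuous_towerPath (x : ℕ → Bool) : Continuous (towerPath x) := by
  refine Continuous.subtype_mk (continuous_pi fun n => ?_) _
  exact (continuous_of_discreteTopology (α := Bool × Fin 3) (β := (diagram x).E n)
    (f := fun e => e)).comp
      (f := fun p : towers x => (p.1.1 (n + 1) 0, p.1.2 n)) (by fun_prop)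

instance (x : ℕ → Bool) : CompactSpace (towers x) :=
  isCompact_iff_compactSpace.1 (isCompact_towers x)

instance (B : OrderedBratteliDiagram) : T2Space B.PathSpace :=
  inferInstanceAs (T2Space {_e : ∀ n, B.E n // _})

/-- Desubstitutions correspond to infinite paths. -/
def pathHomeo (x : ℕ → Bool) : towers x ≃ₜ (diagram x).PathSpace :=
  Continuous.homeoOfEquivCompactToT2 (f := Equiv.ofBijective _ (towerPath_bijective x))
    (continuous_towerPath x)

/-- Desubstitutions correspond to elements of `base x`. -/
def towerHomeo (x : ℕ → Bool) : towers x ≃ₜ base x :=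
  Continuous.homeoOfEquivCompactToT2
    (f := Equiv.Set.imageOfInjOn _ (towers x) (towers_injOn x))
    (Continuous.subtype_mk (by fun_prop) _)

theorem towerHomeo_val (x : ℕ → Bool) (p : towers x) : (towerHomeo x p).1 = p.1.1 0 := rfl

/-- Addition of one with carry: by unique parsing, shifting past the end of a block resets the
offset and shifts the next level. -/
theorem towers_shift_of_eq {x : ℕ → Bool} {p q} (hp : p ∈ towers x) (hq : q ∈ towers x) {n : ℕ}
    (h : q.1 n = shift Bool (p.1 n)) (hk : p.2 n = 2) :
    q.2 n = 0 ∧ q.1 (n + 1) = shift Bool (p.1 (n + 1)) := by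
  have h1 := (hp n).shift_of_eq (by rw [hk]; rfl)
  rw [← h] at h1
  exact ((hq n).unique h1 (towers_full hq _)).2

theorem towers_shift_of_ne {x : ℕ → Bool} {p q} (hp : p ∈ towers x) (hq : q ∈ towers x) {n : ℕ}
    (h : q.1 n = shift Bool (p.1 n)) (hk : p.2 n ≠ 2) :
    (q.2 n : ℕ) = p.2 n + 1 ∧ q.1 (n + 1) = p.1 (n + 1) := by
  have hk2 : (p.2 n : ℕ) + 1 < 3 := by
    have := (p.2 n).2
    have : (p.2 n : ℕ) ≠ 2 := fun h => hk (Fin.ext h)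
    omega
  have h1 := (hp n).shift_of_lt (l := ⟨p.2 n + 1, hk2⟩) rfl
  rw [← h] at h1
  have := ((hq n).unique h1 (towers_full hq _)).2
  exact ⟨by rw [this.1], this.2⟩

theorem towers_shift_below {x : ℕ → Bool} {p q} (hp : p ∈ towers x) (hq : q ∈ towers x)
    (h : q.1 0 = shift Bool (p.1 0)) (n : ℕ) (hk : ∀ j < n, p.2 j = 2) :
    q.1 n = shift Bool (p.1 n) ∧ ∀ j < n, q.2 j = 0 := by
  induction n with
  | zero => exact ⟨h, fun j hj => absurd hj j.not_lt_zero⟩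
  | succ n ih =>
    obtain ⟨h1, h2⟩ := ih fun j hj => hk j (by omega)
    obtain ⟨h3, h4⟩ := towers_shift_of_eq hp hq h1 (hk n n.lt_succ_self)
    refine ⟨h4, fun j hj => ?_⟩
    rcases Nat.lt_succ_iff_lt_or_eq.1 hj with hj | rfl
    · exact h2 j hj
    · exact h3

/-- The Vershik map on the path space. -/
def vershik (x : ℕ → Bool) : (diagram x).PathSpace ≃ₜ (diagram x).PathSpace :=
  ((pathHomeo x).symm.trans (towerHomeo x)).trans
    ((baseMap x).trans ((towerHomeo x).symm.trans (pathHomeo x)))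

theorem conjugate_vershik (x : ℕ → Bool) : Conjugate (baseMap x) (vershik x) :=
  ⟨(towerHomeo x).symm.trans (pathHomeo x), fun s => by simp [vershik]⟩

theorem exists_tower_vershik (x : ℕ → Bool) (p : towers x) :
    ∃ q : towers x, vershik x (towerPath x p) = towerPath x q ∧ q.1.1 0 = shift Bool (p.1.1 0) := by
  refine ⟨(towerHomeo x).symm (baseMap x (towerHomeo x p)), ?_, ?_⟩
  · have e : (pathHomeo x).symm (towerPath x p) = p := (pathHomeo x).symm_apply_apply p
    simp only [vershik, Homeomorph.trans_apply, e]
    rfl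
  · rw [← towerHomeo_val, Homeomorph.apply_symm_apply, baseMap_val, towerHomeo_val]

theorem isMax_towerPath {x : ℕ → Bool} {p : towers x} {n : ℕ} :
    IsMax ((towerPath x p).1 n) ↔ p.1.2 n = 2 := diagram_isMax_iff

theorem isMin_towerPath {x : ℕ → Bool} {p : towers x} {n : ℕ} :
    IsMin ((towerPath x p).1 n) ↔ p.1.2 n = 0 := diagram_isMin_iff

/-- Offset 2 means maximal and offset 0 minimal, so the shift acts as addition with carry: it resets
the initial run of 2s, advances the next offset within the same block, and leaves all higher levels
alone. -/
theorem isVershikMap_vershik (x : ℕ → Bool) : (diagram x).IsVershikMap (vershik x) := by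
  constructor
  · intro e he n
    obtain ⟨p, rfl⟩ := (towerPath_bijective x).2 e
    obtain ⟨q, hq, h⟩ := exists_tower_vershik x p
    rw [hq, isMin_towerPath]
    exact (towers_shift_below p.2 q.2 h (n + 1) fun j _ => isMax_towerPath.1 (he j)).2 n
      n.lt_succ_self
  · intro e k hlt hk
    obtain ⟨p, rfl⟩ := (towerPath_bijective x).2 e
    obtain ⟨q, hq, h⟩ := exists_tower_vershik x p
    obtain ⟨h1, h2⟩ := towers_shift_below p.2 q.2 h k fun j hj => isMax_towerPath.1 (hlt j hj)
    obtain ⟨h3, h4⟩ := towers_shift_of_ne p.2 q.2 h1 fun h => hk (isMax_towerPath.2 h)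
    rw [hq]
    refine ⟨?_, fun j hj => isMin_towerPath.2 (h2 j hj), fun j hj => ?_⟩
    · have := diagram_covBy (x := x) (n := k) (a := p.1.1 (k + 1) 0) h3
      simp only [towerPath, h4]
      exact this
    · have h5 := towers_unique q.2 p.2 h4
      simp only [towerPath]
      rw [(h5 j hj).2.1, (h5 (j + 1) (by omega)).2.2]

theorem existsUnique_path (x : ℕ → Bool) {r : Fin 3} (hr : r = 0 ∨ r = 2) :
    ∃! e : (diagram x).PathSpace, ∀ n, @Prod.snd Bool (Fin 3) (e.1 n) = r := by
  -- At the first or last position of a block the letter does not depend on `a`, so constant offsets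
  -- 0 or 2 force all origin letters and hence the path.
  have hfill : ∀ c a, fill c (r : ℕ) a = fill c (r : ℕ) true := by
    rcases hr with rfl | rfl <;> simp [fill]
  obtain ⟨p, hp, hk, -⟩ := exists_tower (x := x) (fun _ => r) (fun n => fill (x n) (r : ℕ) true)
    (fun n => (hfill _ _).symm)
  refine ⟨towerPath x ⟨p, hp⟩, fun n => congrFun hk n, fun e he => ?_⟩
  obtain ⟨q, rfl⟩ := (towerPath_bijective x).2 e
  have hq : q.1.2 = p.2 := by
    rw [hk]
    exact funext he
  congr 1
  refine Subtype.ext (tower_eq_of_origin q.2 hp hq fun n => ?_)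
  rw [tower_origin q.2, tower_origin hp, hq, hk, hfill, hfill _ (p.1 _ _)]

theorem diagram_properlyOrdered (x : ℕ → Bool) : (diagram x).ProperlyOrdered := by
  simp only [OrderedBratteliDiagram.ProperlyOrdered, diagram_isMax_iff, diagram_isMin_iff]
  exact ⟨existsUnique_path x (Or.inr rfl), existsUnique_path x (Or.inl rfl)⟩

theorem hasTopologicalRank_family (x : ℕ → Bool) : HasTopologicalRank (family x).map 2 :=
  ⟨⟨diagram x, diagram_simple x, diagram_properlyOrdered x, diagram_rank x, vershik x,
    isVershikMap_vershik x, (conjugate_family x).symm.trans (conjugate_vershik x)⟩,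
    fun _ h => two_le_of_hasBVRepresentation (isAperiodic_family x) h⟩

/-! ### Non-smoothness -/

/-- Any relation coarser than conjugacy but still with countable classes is covered, which treats
the three relations at once. -/
theorem not_smoothOn_of_conj {E : Subshift → Subshift → Prop} {C : Set Subshift}
    (hE : ∀ X Y, conj X Y → E X Y) (hcount : ∀ Y, {X | E X Y}.Countable)
    (hC : ∀ x, family x ∈ C) : ¬ SmoothOn E C :=
  not_smoothOn_of_tail continuous_family.measurable family_injective hC
    (fun x y n h => hE _ _ (((conjugate_family x).symm.trans (conjugate_of_eventuallyEq n h)).trans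
      (conjugate_family y))) hcount

theorem not_smoothOn_of_family_mem {C : Set Subshift} (hC : ∀ x, family x ∈ C) :
    ¬ SmoothOn conj C ∧ ¬ SmoothOn flipConj C ∧ ¬ SmoothOn biFactor C :=
  ⟨not_smoothOn_of_conj (fun _ _ h => h) countable_conj hC,
    not_smoothOn_of_conj (fun _ _ h => Or.inl h) countable_flipConj hC,
    not_smoothOn_of_conj (fun _ _ h => ⟨h.symm.isFactorOf, h.isFactorOf⟩) countable_biFactor hC⟩

end ToeplitzRank

end

theorem mainTheorem9 :
    (¬ ToeplitzRank.SmoothOn ToeplitzRank.conj ToeplitzRank.strongToeplitz₂ ∧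
      ¬ ToeplitzRank.SmoothOn ToeplitzRank.flipConj ToeplitzRank.strongToeplitz₂ ∧
      ¬ ToeplitzRank.SmoothOn ToeplitzRank.biFactor ToeplitzRank.strongToeplitz₂) ∧
    (¬ ToeplitzRank.SmoothOn ToeplitzRank.conj ToeplitzRank.toeplitz₂ ∧
      ¬ ToeplitzRank.SmoothOn ToeplitzRank.flipConj ToeplitzRank.toeplitz₂ ∧
      ¬ ToeplitzRank.SmoothOn ToeplitzRank.biFactor ToeplitzRank.toeplitz₂) :=
  ⟨ToeplitzRank.not_smoothOn_of_family_mem ToeplitzRank.isStrongToeplitz_family,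
    ToeplitzRank.not_smoothOn_of_family_mem fun x => ⟨ToeplitzRank.isToeplitz_family x,
      ToeplitzRank.isAperiodic_family x, ToeplitzRank.hasTopologicalRank_family x⟩⟩
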